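/- Let $n$ and $a_0$ be even integers with $2\le a_0\le n-2$, and let $I=[0,a_0-1]\cup[a_0+1,n-1]$, where $[a,b]=\{a,a+1,\dots,b\}$. Let $\Phi=\{\pm(e_i\pm e_j):1\le i<j\le n\}$ be the root system of type $D_n$ with simple roots $\alpha_0=e_1+e_2$ and $\alpha_i=e_{i+1}-e_i$ ($1\le i\le n-1$). Let $\mathcal D_n$ be its Weyl group, that is, the group of bijections $\sigma$ of $\{\pm1,\dots,\pm n\}$ with $\sigma(-i)=-\sigma(i)$ and an even number of negative entries among $\sigma(1),\dots,\sigma(n)$, acting by $e_i\mapsto e_{\sigma(i)}$ with $e_{-i}=-e_i$. Let $s_k$ be the simple reflection in $\alpha_k$, $0\le k\le n-1$. For $w\in\mathcal D_n$ let $\ell(w)$ be the number of positive roots that $w$ sends to negative roots, and let $L(w)$ be the number of positive roots of odd height that $w$ sends to negative roots, where the height of a root is the sum of its coefficients in the simple roots. Let $\mathcal D_n^I=\{w\in\mathcal D_n:\ell(ws_k)>\ell(w)\text{ for all }k\in I\}$ and $$\mathcal D_n^I(x)=\sum_{w\in\mathcal D_n^I}(-1)^{\ell(w)}x^{L(w)}.$$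 Let $I_0,\dots,I_s$ be the connected components of $I$ (its maximal intervals), let $m_I=\sum_{k}\lfloor(|I_k|+1)/2\rfloor$, and let $$C_I=\frac{[m_I]_{q}!}{\prod_{k}\big[\lfloor(|I_k|+1)/2\rfloor\big]_{q}!}\Bigg|_{q=x^2},\qquad [m]_q!=\prod_{i=1}^m\frac{1-q^i}{1-q}.$$ Then, as rational functions in $x$, $$\mathcal D_n^I(x)=C_I\,\frac{1+x^{a_0}+2x^{n/2}}{1+x^{n/2}}\prod_{i=a_0+2}^{n}\left(1+(-1)^{i-1}x^{\lfloor i/2\rfloor}\right).$$ -/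

import Mathlib

open Polynomial

namespace OddLengthD

noncomputable section

/-! ### Signed permutations and the even hyperoctahedral group -/

/-- The set `[n]_± = {-n, …, -1, 1, …, n}`. -/
abbrev SignedIndex (n : ℕ) : Type :=
  {k : ℤ // k ∈ (Finset.Icc (-(n : ℤ)) (n : ℤ)).erase 0}

/-- The element `k` of `[n]_±`. -/
def point {n : ℕ} (k : ℤ) (h0 : k ≠ 0) (h1 : -(n : ℤ) ≤ k) (h2 : k ≤ n) : SignedIndex n :=
  ⟨k, Finset.mem_erase.mpr ⟨h0, Finset.mem_Icc.mpr ⟨h1, h2⟩⟩⟩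

/-- The element `i + 1` of `[n] ⊆ [n]_±`, for `0 ≤ i < n`. -/
def posPoint {n : ℕ} (i : Fin n) : SignedIndex n :=
  point ((i : ℤ) + 1) (by omega) (by omega) (by omega)

/-- A bijection `σ` of `[n]_±` is a signed permutation if `σ(-i) = -σ(i)`. -/
def IsSigned {n : ℕ} (σ : Equiv.Perm (SignedIndex n)) : Prop :=
  ∀ i j : SignedIndex n, (j : ℤ) = -(i : ℤ) → (σ j : ℤ) = -(σ i : ℤ)

open Classical in
/-- The even hyperoctahedral group `𝒟_n`: the signed permutations whose one-line notation
`σ(1) σ(2) ⋯ σ(n)` has an even number of negative entries.  The product of two of its elements is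
the product in `Equiv.Perm`, that is, composition. -/
def evenHyperoctahedral (n : ℕ) : Finset (Equiv.Perm (SignedIndex n)) :=
  Finset.univ.filter fun σ =>
    IsSigned σ ∧ Even (Finset.univ.filter fun i : Fin n => (σ (posPoint i) : ℤ) < 0).card

/-- The Coxeter generators of `𝒟_n` (for `n ≥ 2`): `s_0 = (1, -2)(2, -1)` and
`s_k = (k, k+1)(-k, -(k+1))` for `1 ≤ k ≤ n - 1`.  (The value is `1` outside this range.) -/
def simpleReflection (n k : ℕ) : Equiv.Perm (SignedIndex n) :=
  if h : k < n ∧ 2 ≤ n then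
    if hk : k = 0 then
      Equiv.swap (point 1 (by omega) (by omega) (by omega))
          (point (-2) (by omega) (by omega) (by omega)) *
        Equiv.swap (point 2 (by omega) (by omega) (by omega))
          (point (-1) (by omega) (by omega) (by omega))
    else
      Equiv.swap (point (k : ℤ) (by omega) (by omega) (by omega))
          (point ((k : ℤ) + 1) (by omega) (by omega) (by omega)) *
        Equiv.swap (point (-(k : ℤ)) (by omega) (by omega) (by omega))
          (point (-((k : ℤ) + 1)) (by omega) (by omega) (by omega))
  else 1

/-! ### The root system of type `D_n`, length and odd length -/

/-- For `1 ≤ j ≤ n`, `e n j` is the standard basis vector `e_j` of `ℤⁿ`, and `e n (-j) = -e_j`. -/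
def e (n : ℕ) (j : ℤ) : Fin n → ℤ := fun i =>
  if j = (i : ℤ) + 1 then 1 else if j = -((i : ℤ) + 1) then -1 else 0

/-- `Φ = {±(e_i ± e_j) : 1 ≤ i < j ≤ n}`. -/
def IsRoot (n : ℕ) (v : Fin n → ℤ) : Prop :=
  ∃ i j : ℕ, 1 ≤ i ∧ i < j ∧ j ≤ n ∧
    (v = e n i + e n j ∨ v = -(e n i + e n j) ∨ v = e n i - e n j ∨ v = -(e n i - e n j))

/-- The simple roots, indexed by `0 ≤ k ≤ n - 1`: `e_1 + e_2` for `k = 0` and `e_{k+1} - e_k` for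
`k ≥ 1`. -/
def simpleRoot (n k : ℕ) : Fin n → ℤ :=
  if k = 0 then e n 1 + e n 2 else e n ((k : ℤ) + 1) - e n (k : ℤ)

/-- `v` is a positive root: a root that is a nonnegative combination of simple roots. -/
def IsPosRoot (n : ℕ) (v : Fin n → ℤ) : Prop :=
  IsRoot n v ∧ ∃ c : ℕ → ℕ, v = ∑ k ∈ Finset.range n, (c k : ℤ) • simpleRoot n k

/-- `v` is a negative root: the negative of a positive root. -/
def IsNegRoot (n : ℕ) (v : Fin n → ℤ) : Prop := IsPosRoot n (-v)

/-- The height of `v` is odd: the sum of the coefficients in the expansion of `v` in the simple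
roots is odd (for `n ≥ 2` the simple roots are linearly independent, so the expansion is unique). -/
def HasOddHeight (n : ℕ) (v : Fin n → ℤ) : Prop :=
  ∃ c : ℕ → ℤ, v = ∑ k ∈ Finset.range n, c k • simpleRoot n k ∧ Odd (∑ k ∈ Finset.range n, c k)

/-- The linear action of a signed permutation on `ℤⁿ`: `e_i ↦ e_{σ(i)}`, where `e_{-i} = -e_i`. -/
def act {n : ℕ} (σ : Equiv.Perm (SignedIndex n)) (v : Fin n → ℤ) : Fin n → ℤ :=
  ∑ i : Fin n, v i • e n (σ (posPoint i) : ℤ)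

/-- The Coxeter length: the number of positive roots sent to negative roots. -/
def len {n : ℕ} (σ : Equiv.Perm (SignedIndex n)) : ℕ :=
  Set.ncard {v : Fin n → ℤ | IsPosRoot n v ∧ IsNegRoot n (act σ v)}

/-- The odd length: the number of positive roots of odd height sent to negative roots. -/
def oddLen {n : ℕ} (σ : Equiv.Perm (SignedIndex n)) : ℕ :=
  Set.ncard {v : Fin n → ℤ | IsPosRoot n v ∧ HasOddHeight n v ∧ IsNegRoot n (act σ v)}

/-! ### Parabolic quotients and the generating function -/

open Classical in
/-- The parabolic quotient `𝒟_n^I = {w ∈ 𝒟_n : ℓ(w s_k) > ℓ(w) for all k ∈ I}`, for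
`I ⊆ [0, n-1]`. -/
def quotient (n : ℕ) (I : Finset ℕ) : Finset (Equiv.Perm (SignedIndex n)) :=
  (evenHyperoctahedral n).filter fun w => ∀ k ∈ I, len w < len (w * simpleReflection n k)

/-- The sign-twisted generating function `𝒟_n^I(x) = ∑_{w ∈ 𝒟_n^I} (-1)^{ℓ(w)} x^{L(w)}`. -/
def genFun (n : ℕ) (I : Finset ℕ) : ℤ[X] :=
  ∑ w ∈ quotient n I, (-1) ^ len w * X ^ oddLen w

/-! ### `q`-multinomial coefficients and the constant `C_I` -/

/-- `[n]_q = (1 - q^n) / (1 - q)`. -/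
def qNumber (q : RatFunc ℤ) (n : ℕ) : RatFunc ℤ := (1 - q ^ n) / (1 - q)

/-- `[n]_q! = [1]_q [2]_q ⋯ [n]_q`. -/
def qFactorial (q : RatFunc ℤ) (n : ℕ) : RatFunc ℤ := ∏ i ∈ Finset.Icc 1 n, qNumber q i

/-- The `q`-multinomial coefficient with lower entries `f i`, `i ∈ s`, and upper entry their
sum. -/
def qMultinomial {ι : Type} (q : RatFunc ℤ) (s : Finset ι) (f : ι → ℕ) : RatFunc ℤ :=
  qFactorial q (∑ i ∈ s, f i) / ∏ i ∈ s, qFactorial q (f i)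

open Classical in
/-- The connected components of a finite set `I ⊆ ℕ`: its nonempty maximal intervals.  (If `0 ∉ I`,
the additional empty component `I_0` would contribute a lower entry `⌊(0 + 1) / 2⌋ = 0` to `C_I`,
which has no effect, so it is not listed.) -/
def components (I : Finset ℕ) : Finset (Finset ℕ) :=
  I.powerset.filter fun J =>
    ∃ a b : ℕ, a ≤ b ∧ J = Finset.Icc a b ∧ (∀ c ∈ I, c + 1 ≠ a) ∧ b + 1 ∉ I

/-- `C_I`: the `q`-multinomial coefficient at `q = x²` whose lower entries are
`⌊(|J| + 1) / 2⌋` for the connected components `J` of `I`. -/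
def constC (I : Finset ℕ) : RatFunc ℤ :=
  qMultinomial (RatFunc.X ^ 2) (components I) fun J => (J.card + 1) / 2

end

end OddLengthD

namespace OddLengthD

noncomputable section

/-! Write `a` for `a₀` and `m = n - a`. Both statistics count pairs of positions: for `i < j` the
roots `e_j - e_i` and `e_j + e_i` become negative when `w(j) < w(i)` and when `w(i) + w(j) < 0`, and
the odd length keeps the pairs with `i + j` odd (`len_eq`, `oddLen_eq`). The descent conditions make
the one-line notation increasing on the first `a` and on the last `m` positions, with `w(1) + w(2) >
0`. Only `w(1)` in the first block can then be negative. Its sign does not affect the statistics and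
is determined by the parity of the number of negative entries. Hence the quotient is in bijection
with the pairs `(u, v)` of `splits a m`, and the sum is a `splitSum` (`sum_quotient_eq_splitSum`).

In such a pair the largest absolute value `N` is the last entry of `u`, the last entry of `v`, or,
with a minus sign, the first entry of `v`. Deleting it gives the recursion `splitSum_succ_succ`. The
third case shifts the positions of `v` by one, so the parity `b` of the starting position of `v` has
to be carried along. A joint induction over the parities of both lengths and of `b` gives closed
forms (`evenEven`). The common factor `coreFactor` is `C_I` times the product over `i`, up to a
factor `1 + x^{n/2}` (`constC_eq`, `prod_Icc_eq`). -/

/-- The one-line notation of `σ`. -/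
def window {n : ℕ} (σ : Equiv.Perm (SignedIndex n)) (i : Fin n) : ℤ := (σ (posPoint i) : ℤ)

/-! ### Height and the positive roots of type D. -/

/-- The height, as a linear functional on `ℤⁿ`. -/
def height {n : ℕ} (v : Fin n → ℤ) : ℤ := ∑ i : Fin n, (i : ℤ) * v i

lemma height_add {n : ℕ} (v w : Fin n → ℤ) : height (v + w) = height v + height w := by
  simp [height, mul_add, Finset.sum_add_distrib]

lemma height_neg {n : ℕ} (v : Fin n → ℤ) : height (-v) = -height v := by
  simp [height]

lemma height_sub {n : ℕ} (v w : Fin n → ℤ) : height (v - w) = height v - height w := by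
  rw [sub_eq_add_neg, height_add, height_neg, sub_eq_add_neg]

lemma height_smul {n : ℕ} (c : ℤ) (v : Fin n → ℤ) : height (c • v) = c * height v := by
  simp only [height, Finset.mul_sum, Pi.smul_apply, smul_eq_mul]
  exact Finset.sum_congr rfl fun i _ => by ring

lemma height_sum {n : ℕ} {ι : Type*} (s : Finset ι) (f : ι → Fin n → ℤ) :
    height (∑ k ∈ s, f k) = ∑ k ∈ s, height (f k) := by
  classical
  induction s using Finset.induction_on with
  | empty => simp [height]
  | insert a s ha ih => rw [Finset.sum_insert ha, Finset.sum_insert ha, height_add, ih]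

lemma e_succ {n : ℕ} (i : Fin n) : e n ((i : ℤ) + 1) = Pi.single i 1 := by
  funext j
  simp only [e, Pi.single_apply, Fin.ext_iff]
  split_ifs <;> omega

lemma e_neg {n : ℕ} (k : ℤ) : e n (-k) = -e n k := by
  funext j
  simp only [e, Pi.neg_apply]
  split_ifs <;> omega

lemma height_single {n : ℕ} (i : Fin n) : height (Pi.single i (1 : ℤ)) = i := by
  simp [height, Pi.single_apply]

lemma exists_fin_of_pos {n : ℕ} {k : ℤ} (h0 : 0 < k) (hn : k ≤ n) :
    ∃ i : Fin n, k = (i : ℤ) + 1 :=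
  ⟨⟨(k - 1).toNat, by omega⟩, by simp only; omega⟩

lemma height_e {n : ℕ} (k : ℤ) (h0 : k ≠ 0) (h1 : -(n : ℤ) ≤ k) (h2 : k ≤ n) :
    height (e n k) = if 0 < k then k - 1 else k + 1 := by
  split_ifs with h
  · obtain ⟨i, rfl⟩ := exists_fin_of_pos h h2
    rw [e_succ, height_single]; ring
  · obtain ⟨i, hi⟩ := exists_fin_of_pos (k := -k) (n := n) (by omega) (by omega)
    rw [← neg_neg k, e_neg, height_neg, hi, e_succ, height_single]; ring

lemma isRoot_iff {n : ℕ} (v : Fin n → ℤ) :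
    IsRoot n v ↔ ∃ i j : Fin n, i < j ∧
      (v = Pi.single j 1 - Pi.single i 1 ∨ v = Pi.single j 1 + Pi.single i 1 ∨
       v = -(Pi.single j 1 - Pi.single i 1) ∨ v = -(Pi.single j 1 + Pi.single i 1)) := by
  constructor
  · rintro ⟨i, j, h1, h2, h3, h⟩
    obtain ⟨i', hi⟩ := exists_fin_of_pos (n := n) (k := i) (by omega) (by omega)
    obtain ⟨j', hj⟩ := exists_fin_of_pos (n := n) (k := j) (by omega) (by omega)
    refine ⟨i', j', by rw [Fin.lt_def]; omega, ?_⟩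
    rw [hi, hj, e_succ, e_succ] at h
    rcases h with h | h | h | h
    · right; left; rw [h, add_comm]
    · right; right; right; rw [h, add_comm]
    · right; right; left; rw [h, neg_sub]
    · left; rw [h, neg_sub]
  · rintro ⟨i, j, h1, h⟩
    rw [Fin.lt_def] at h1
    refine ⟨i + 1, j + 1, by omega, by omega, by omega, ?_⟩
    have hi : e n ((i + 1 : ℕ) : ℤ) = Pi.single i 1 := by rw [← e_succ]; push_cast; rfl
    have hj : e n ((j + 1 : ℕ) : ℤ) = Pi.single j 1 := by rw [← e_succ]; push_cast; rfl
    rw [hi, hj]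
    rcases h with h | h | h | h
    · right; right; right; rw [h, neg_sub]
    · left; rw [h, add_comm]
    · right; right; left; rw [h, neg_sub]
    · right; left; rw [h, add_comm]

/-- The weights `0, …, n - 1` are chosen for this: consecutive weights differ by one and the first
two add up to one. Any expansion in simple roots therefore has coefficient sum `height v`. -/
lemma height_simpleRoot {n k : ℕ} (hn : 2 ≤ n) (hk : k < n) : height (simpleRoot n k) = 1 := by
  unfold simpleRoot
  split_ifs with h
  · rw [height_add, height_e _ (by omega) (by omega) (by omega),
      height_e _ (by omega) (by omega) (by omega)]
    norm_num
  · rw [height_sub, height_e _ (by omega) (by omega) (by omega),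
      height_e _ (by omega) (by omega) (by omega), if_pos (by omega), if_pos (by omega)]
    ring

lemma height_combination {n : ℕ} (hn : 2 ≤ n) (c : ℕ → ℤ) :
    height (∑ k ∈ Finset.range n, c k • simpleRoot n k) = ∑ k ∈ Finset.range n, c k := by
  rw [height_sum]
  refine Finset.sum_congr rfl fun k hk => ?_
  rw [height_smul, height_simpleRoot hn (Finset.mem_range.mp hk), mul_one]

/-- The nonnegative combinations of simple roots. -/
def simpleCone (n : ℕ) : AddSubmonoid (Fin n → ℤ) where
  carrier := {v | ∃ c : ℕ → ℕ, v = ∑ k ∈ Finset.range n, (c k : ℤ) • simpleRoot n k}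
  zero_mem' := ⟨0, by simp⟩
  add_mem' := by
    rintro v w ⟨c, rfl⟩ ⟨d, rfl⟩
    exact ⟨c + d, by simp [add_smul, Finset.sum_add_distrib]⟩

lemma simpleRoot_mem_cone {n k : ℕ} (hk : k < n) : simpleRoot n k ∈ simpleCone n :=
  ⟨fun l => if l = k then 1 else 0, by simp [hk]⟩

/-- The difference telescopes into the simple roots between the two positions. -/
lemma single_sub_mem_cone {n : ℕ} {i j : Fin n} (h : i ≤ j) :
    (Pi.single j 1 - Pi.single i 1 : Fin n → ℤ) ∈ simpleCone n := by
  obtain ⟨i, hi⟩ := i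
  obtain ⟨j, hj⟩ := j
  simp only [Fin.mk_le_mk] at h
  induction j, h using Nat.le_induction with
  | base => simp
  | succ j hij ih =>
    have h1 := ih (by omega)
    have h2 : simpleRoot n (j + 1) ∈ simpleCone n := simpleRoot_mem_cone hj
    have h3 : simpleRoot n (j + 1) =
        Pi.single (⟨j + 1, hj⟩ : Fin n) 1 - Pi.single (⟨j, by omega⟩ : Fin n) 1 := by
      rw [← e_succ, ← e_succ]
      simp [simpleRoot]
    rw [h3] at h2
    simpa using AddSubmonoid.add_mem _ h1 h2

/-- In one-based notation, `e_i + e_j = α_0 + (e_i - e_1) + (e_j - e_2)`; here `i < j` ensures `j ≥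
2`. -/
lemma single_add_mem_cone {n : ℕ} {i j : Fin n} (h : i < j) :
    (Pi.single j 1 + Pi.single i 1 : Fin n → ℤ) ∈ simpleCone n := by
  rw [Fin.lt_def] at h
  have h0 : simpleRoot n 0 ∈ simpleCone n := simpleRoot_mem_cone (by omega)
  have h3 : simpleRoot n 0 =
      Pi.single (⟨0, by omega⟩ : Fin n) 1 + Pi.single (⟨1, by omega⟩ : Fin n) 1 := by
    rw [← e_succ, ← e_succ]
    simp [simpleRoot]
  rw [h3] at h0
  have h1 := single_sub_mem_cone (n := n) (i := ⟨0, by omega⟩) (j := i) (by simp [Fin.le_def])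
  have h2 := single_sub_mem_cone (n := n) (i := ⟨1, by omega⟩) (j := j)
    (by rw [Fin.le_def]; simp only; omega)
  convert AddSubmonoid.add_mem _ h0 (AddSubmonoid.add_mem _ h1 h2) using 1
  abel

/-- Nonnegative combinations have nonnegative height, whereas the two excluded families have heights
`-(j ∓ i) < 0`. -/
lemma isPosRoot_iff {n : ℕ} (v : Fin n → ℤ) :
    IsPosRoot n v ↔ ∃ i j : Fin n, i < j ∧
      (v = Pi.single j 1 - Pi.single i 1 ∨ v = Pi.single j 1 + Pi.single i 1) := by
  unfold IsPosRoot
  rw [isRoot_iff]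
  constructor
  · rintro ⟨⟨i, j, hij, h⟩, c, hc⟩
    refine ⟨i, j, hij, ?_⟩
    rw [Fin.lt_def] at hij
    have h0 : 0 ≤ height v := by
      rw [hc, height_combination (by omega)]
      positivity
    rcases h with h | h | h | h
    · exact .inl h
    · exact .inr h
    · rw [h, height_neg, height_sub, height_single, height_single] at h0; omega
    · rw [h, height_neg, height_add, height_single, height_single] at h0; omega
  · rintro ⟨i, j, hij, h⟩
    refine ⟨⟨i, j, hij, by tauto⟩, ?_⟩
    rcases h with rfl | rfl
    · exact single_sub_mem_cone hij.le
    · exact single_add_mem_cone hij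

lemma isPosRoot_iff_height {n : ℕ} {v : Fin n → ℤ} (hv : IsRoot n v) :
    IsPosRoot n v ↔ 0 < height v := by
  rw [isRoot_iff] at hv
  rw [isPosRoot_iff]
  constructor
  · rintro ⟨i, j, hij, rfl | rfl⟩ <;> rw [Fin.lt_def] at hij <;>
      simp only [height_sub, height_add, height_single] <;> omega
  · intro h
    obtain ⟨i, j, hij, h'⟩ := hv
    refine ⟨i, j, hij, ?_⟩
    rw [Fin.lt_def] at hij
    rcases h' with h' | h' | h' | h'
    · exact .inl h'
    · exact .inr h'
    · rw [h', height_neg, height_sub, height_single, height_single] at h; omega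
    · rw [h', height_neg, height_add, height_single, height_single] at h; omega

lemma hasOddHeight_iff {n : ℕ} {v : Fin n → ℤ} (hv : IsPosRoot n v) :
    HasOddHeight n v ↔ Odd (height v) := by
  obtain ⟨i, j, hij, -⟩ := (isPosRoot_iff v).mp hv
  rw [Fin.lt_def] at hij
  have hn : 2 ≤ n := by omega
  constructor
  · rintro ⟨c, hc, ho⟩
    rwa [hc, height_combination hn]
  · intro h
    obtain ⟨-, c, hc⟩ := hv
    refine ⟨fun k => c k, hc, ?_⟩
    rwa [hc, height_combination hn] at h

lemma isRoot_e_add_e {n : ℕ} {x y : ℤ} (hx : x ≠ 0) (hy : y ≠ 0) (hxn : |x| ≤ n) (hyn : |y| ≤ n)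
    (hxy : |x| ≠ |y|) : IsRoot n (e n x + e n y) := by
  have hx' := Int.abs_eq_natAbs x
  have hy' := Int.abs_eq_natAbs y
  wlog h : |x| < |y| generalizing x y
  · rw [add_comm]
    exact this hy hx hyn hxn hxy.symm hy' hx' (by omega)
  refine ⟨x.natAbs, y.natAbs, by omega, by omega, by omega, ?_⟩
  rcases Int.natAbs_eq x with h1 | h1 <;> rcases Int.natAbs_eq y with h2 | h2
  · left; rw [← h1, ← h2]
  · right; right; left
    rw [← h1, sub_eq_add_neg, ← e_neg, ← h2]
  · right; right; right
    rw [← h2, neg_sub, add_comm, sub_eq_add_neg, ← e_neg, ← h1]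
  · right; left
    rw [neg_add, ← e_neg, ← e_neg, ← h1, ← h2]

/-- The height of `e_x + e_y` is `x + y` with each entry moved one step towards zero. For equal
signs, `|x| ≠ |y|` gives `|x + y| ≥ 3`, so the sign survives; for opposite signs the shifts cancel.
-/
lemma isNegRoot_e_add_e {n : ℕ} {x y : ℤ} (hx : x ≠ 0) (hy : y ≠ 0) (hxn : |x| ≤ n)
    (hyn : |y| ≤ n) (hxy : |x| ≠ |y|) : IsNegRoot n (e n x + e n y) ↔ x + y < 0 := by
  have hx' := Int.abs_eq_natAbs x
  have hy' := Int.abs_eq_natAbs y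
  have hr : IsRoot n (-(e n x + e n y)) := by
    rw [neg_add, ← e_neg, ← e_neg]
    exact isRoot_e_add_e (by omega) (by omega) (by rwa [abs_neg]) (by rwa [abs_neg])
      (by rwa [abs_neg, abs_neg])
  rw [IsNegRoot, isPosRoot_iff_height hr, height_neg, height_add, height_e x hx (by omega)
    (by omega), height_e y hy (by omega) (by omega)]
  split_ifs <;> omega

/-! ### Length and odd length read off the one-line notation. -/

lemma act_add {n : ℕ} (σ : Equiv.Perm (SignedIndex n)) (v w : Fin n → ℤ) :
    act σ (v + w) = act σ v + act σ w := by
  simp [act, add_smul, Finset.sum_add_distrib]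

lemma act_sub {n : ℕ} (σ : Equiv.Perm (SignedIndex n)) (v w : Fin n → ℤ) :
    act σ (v - w) = act σ v - act σ w := by
  simp [act, sub_smul, Finset.sum_sub_distrib]

lemma act_single {n : ℕ} (σ : Equiv.Perm (SignedIndex n)) (i : Fin n) :
    act σ (Pi.single i 1) = e n (window σ i) := by
  rw [act, Finset.sum_eq_single i]
  · simp [window]
  · intro j _ hj; simp [hj]
  · simp

lemma window_ne_zero {n : ℕ} (σ : Equiv.Perm (SignedIndex n)) (i : Fin n) : window σ i ≠ 0 :=
  (Finset.mem_erase.mp (σ (posPoint i)).2).1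

lemma abs_window_le {n : ℕ} (σ : Equiv.Perm (SignedIndex n)) (i : Fin n) : |window σ i| ≤ n := by
  have := Finset.mem_Icc.mp (Finset.mem_erase.mp (σ (posPoint i)).2).2
  rw [abs_le]; exact this

/-- The element `-(i + 1)` of `[n]_±`, for `0 ≤ i < n`. -/
def negPoint {n : ℕ} (i : Fin n) : SignedIndex n :=
  point (-((i : ℤ) + 1)) (by omega) (by omega) (by omega)

lemma IsSigned.apply_negPoint {n : ℕ} {σ : Equiv.Perm (SignedIndex n)} (hσ : IsSigned σ)
    (i : Fin n) : (σ (negPoint i) : ℤ) = -window σ i := by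
  rw [window]
  exact hσ (posPoint i) (negPoint i) rfl

lemma IsSigned.abs_window_injective {n : ℕ} {σ : Equiv.Perm (SignedIndex n)} (hσ : IsSigned σ) :
    Function.Injective fun i => |window σ i| := by
  intro i j h
  rcases abs_eq_abs.mp h with h | h
  · have h1 := congrArg Subtype.val (σ.injective (Subtype.ext h))
    simp only [posPoint, point] at h1
    exact Fin.ext (by omega)
  · rw [← hσ.apply_negPoint] at h
    have h1 := congrArg Subtype.val (σ.injective (Subtype.ext h))
    simp only [posPoint, negPoint, point] at h1
    omega

/-- The number of the roots `e_j - e_i`, `e_j + e_i` that are sent to negative roots by a signed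
permutation with `i ↦ x` and `j ↦ y`. -/
def pairInv (x y : ℤ) : ℕ := (if y < x then 1 else 0) + if x + y < 0 then 1 else 0

lemma sum_pairInv {n : ℕ} (p : Fin n → Fin n → Prop) [∀ i j, Decidable (p i j)] (w : Fin n → ℤ) :
    ∑ i, ∑ j, (if p i j then pairInv (w i) (w j) else 0) =
      (Finset.univ.filter fun q : Fin n × Fin n => p q.1 q.2 ∧ w q.2 < w q.1).card +
      (Finset.univ.filter fun q : Fin n × Fin n => p q.1 q.2 ∧ w q.1 + w q.2 < 0).card := by
  rw [Finset.card_filter, Finset.card_filter, Fintype.sum_prod_type, Fintype.sum_prod_type,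
    ← Finset.sum_add_distrib]
  refine Finset.sum_congr rfl fun i _ => ?_
  rw [← Finset.sum_add_distrib]
  refine Finset.sum_congr rfl fun j _ => ?_
  by_cases h : p i j <;> simp [h, pairInv]

lemma single_sub_injOn {n : ℕ} : Set.InjOn
    (fun q : Fin n × Fin n => (Pi.single q.2 1 - Pi.single q.1 1 : Fin n → ℤ))
    {q | q.1 < q.2} := by
  rintro ⟨i, j⟩ h ⟨i', j'⟩ h' heq
  simp only [Set.mem_ofPred_eq] at h h'
  have h1 := congrFun heq i
  have h2 := congrFun heq j
  simp only [Pi.sub_apply, Pi.single_apply] at h1 h2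
  simp only [Prod.mk.injEq]
  split_ifs at h1 h2 <;> omega

lemma single_add_injOn {n : ℕ} : Set.InjOn
    (fun q : Fin n × Fin n => (Pi.single q.2 1 + Pi.single q.1 1 : Fin n → ℤ))
    {q | q.1 < q.2} := by
  rintro ⟨i, j⟩ h ⟨i', j'⟩ h' heq
  simp only [Set.mem_ofPred_eq] at h h'
  have h1 := congrFun heq i
  have h2 := congrFun heq j
  simp only [Pi.add_apply, Pi.single_apply] at h1 h2
  simp only [Prod.mk.injEq]
  split_ifs at h1 h2 <;> omega

lemma ncard_posRoots {n : ℕ} (P : (Fin n → ℤ) → Prop)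
    (Q Q' : Fin n × Fin n → Prop) [DecidablePred Q] [DecidablePred Q']
    (hQ : ∀ q : Fin n × Fin n, Q q ↔ q.1 < q.2 ∧ P (Pi.single q.2 1 - Pi.single q.1 1))
    (hQ' : ∀ q : Fin n × Fin n, Q' q ↔ q.1 < q.2 ∧ P (Pi.single q.2 1 + Pi.single q.1 1)) :
    Set.ncard {v : Fin n → ℤ | IsPosRoot n v ∧ P v} =
      (Finset.univ.filter Q).card + (Finset.univ.filter Q').card := by
  have h : {v : Fin n → ℤ | IsPosRoot n v ∧ P v} =
      (fun q : Fin n × Fin n => (Pi.single q.2 1 - Pi.single q.1 1 : Fin n → ℤ)) ''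
        (Finset.univ.filter Q : Finset (Fin n × Fin n)) ∪
      (fun q : Fin n × Fin n => (Pi.single q.2 1 + Pi.single q.1 1 : Fin n → ℤ)) ''
        (Finset.univ.filter Q' : Finset (Fin n × Fin n)) := by
    ext v
    simp only [Set.mem_ofPred_eq, isPosRoot_iff, Finset.coe_filter, Finset.mem_univ, true_and,
      Set.mem_union, Set.mem_image, Prod.exists, hQ, hQ']
    constructor
    · rintro ⟨⟨i, j, hij, rfl | rfl⟩, hP⟩
      · exact .inl ⟨i, j, ⟨hij, hP⟩, rfl⟩
      · exact .inr ⟨i, j, ⟨hij, hP⟩, rfl⟩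
    · rintro (⟨i, j, ⟨hij, hP⟩, rfl⟩ | ⟨i, j, ⟨hij, hP⟩, rfl⟩)
      · exact ⟨⟨i, j, hij, .inl rfl⟩, hP⟩
      · exact ⟨⟨i, j, hij, .inr rfl⟩, hP⟩
  rw [h, Set.ncard_union_eq, Set.InjOn.ncard_image, Set.InjOn.ncard_image,
    Set.ncard_coe_finset, Set.ncard_coe_finset]
  · exact single_add_injOn.mono fun q hq => ((hQ' q).mp (by simpa using hq)).1
  · exact single_sub_injOn.mono fun q hq => ((hQ q).mp (by simpa using hq)).1
  · rw [Set.disjoint_left]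
    rintro v ⟨⟨i, j⟩, -, rfl⟩ ⟨⟨i', j'⟩, -, h2⟩
    -- The two families are separated by their coordinate sums, `0` and `2`.
    have h3 := congrArg (fun v : Fin n → ℤ => ∑ i, v i) h2
    simp [Finset.sum_add_distrib, Finset.sum_sub_distrib] at h3

lemma isNegRoot_act_sub {n : ℕ} {σ : Equiv.Perm (SignedIndex n)} (hσ : IsSigned σ) {i j : Fin n}
    (hij : i < j) :
    IsNegRoot n (act σ (Pi.single j 1 - Pi.single i 1)) ↔ window σ j < window σ i := by
  rw [act_sub, act_single, act_single, sub_eq_add_neg, ← e_neg,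
    isNegRoot_e_add_e (window_ne_zero σ j) (neg_ne_zero.mpr (window_ne_zero σ i))
      (abs_window_le σ j) (by rw [abs_neg]; exact abs_window_le σ i)
      (by rw [abs_neg]; exact fun h => hij.ne' (hσ.abs_window_injective h))]
  omega

lemma isNegRoot_act_add {n : ℕ} {σ : Equiv.Perm (SignedIndex n)} (hσ : IsSigned σ) {i j : Fin n}
    (hij : i < j) :
    IsNegRoot n (act σ (Pi.single j 1 + Pi.single i 1)) ↔ window σ i + window σ j < 0 := by
  rw [act_add, act_single, act_single,
    isNegRoot_e_add_e (window_ne_zero σ j) (window_ne_zero σ i)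
      (abs_window_le σ j) (abs_window_le σ i) (fun h => hij.ne' (hσ.abs_window_injective h)),
    add_comm]

theorem len_eq {n : ℕ} {σ : Equiv.Perm (SignedIndex n)} (hσ : IsSigned σ) :
    len σ = ∑ i, ∑ j, if i < j then pairInv (window σ i) (window σ j) else 0 := by
  rw [sum_pairInv, len]
  refine ncard_posRoots _ _ _ (fun q => ?_) (fun q => ?_)
  · exact and_congr_right fun h => (isNegRoot_act_sub hσ h).symm
  · exact and_congr_right fun h => (isNegRoot_act_add hσ h).symm

theorem oddLen_eq {n : ℕ} {σ : Equiv.Perm (SignedIndex n)} (hσ : IsSigned σ) :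
    oddLen σ = ∑ i : Fin n, ∑ j : Fin n,
      if i < j ∧ ((i : ℕ) + j) % 2 = 1 then pairInv (window σ i) (window σ j) else 0 := by
  rw [sum_pairInv, oddLen]
  refine ncard_posRoots _ _ _ (fun q => ?_) (fun q => ?_)
  · rw [and_assoc]
    refine and_congr_right fun h => ?_
    rw [isNegRoot_act_sub hσ h, hasOddHeight_iff ((isPosRoot_iff _).mpr ⟨_, _, h, .inl rfl⟩),
      height_sub, height_single, height_single, Int.odd_iff]
    refine and_congr_left fun _ => ?_
    omega
  · rw [and_assoc]
    refine and_congr_right fun h => ?_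
    rw [isNegRoot_act_add hσ h, hasOddHeight_iff ((isPosRoot_iff _).mpr ⟨_, _, h, .inr rfl⟩),
      height_add, height_single, height_single, Int.odd_iff]
    refine and_congr_left fun _ => ?_
    omega

/-! ### Right multiplication by simple reflections and descents. -/

/-- The sum of `pairInv` over the pairs of positions. -/
def pairSum {n : ℕ} (w : Fin n → ℤ) : ℕ := ∑ i, ∑ j, if i < j then pairInv (w i) (w j) else 0

lemma pairSum_eq_add {n : ℕ} (w : Fin n → ℤ) {a b : Fin n} (hab : a < b) :
    pairSum w = pairInv (w a) (w b) +
      ∑ q ∈ (Finset.univ.filter fun q : Fin n × Fin n => q.1 < q.2).erase (a, b),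
        pairInv (w q.1) (w q.2) := by
  have h := Finset.add_sum_erase (Finset.univ.filter fun q : Fin n × Fin n => q.1 < q.2)
    (fun q => pairInv (w q.1) (w q.2)) (a := (a, b)) (by simpa using hab)
  rw [h, Finset.sum_filter, Fintype.sum_prod_type, pairSum]

lemma swap_lt_swap {n : ℕ} {a b i j : Fin n} (hab : (b : ℕ) = a + 1) (hij : i < j)
    (h : (i, j) ≠ (a, b)) : Equiv.swap a b i < Equiv.swap a b j := by
  simp only [Equiv.swap_apply_def, ne_eq, Prod.mk.injEq, Fin.ext_iff, Fin.lt_def] at *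
  split_ifs <;> omega

/-- Swapping two adjacent positions permutes the other increasing pairs of positions, so their
contributions cancel and only the pair `(a, b)` decides. -/
lemma pairSum_lt_iff {n : ℕ} (w w' : Fin n → ℤ) {a b : Fin n} (hab : (b : ℕ) = a + 1)
    (h : ∀ i j, i < j → (i, j) ≠ (a, b) →
      pairInv (w' (Equiv.swap a b i)) (w' (Equiv.swap a b j)) = pairInv (w i) (w j)) :
    pairSum w < pairSum w' ↔ pairInv (w a) (w b) < pairInv (w' a) (w' b) := by
  have hlt : a < b := by rw [Fin.lt_def]; omega
  rw [pairSum_eq_add w hlt, pairSum_eq_add w' hlt]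
  rw [show ∑ q ∈ (Finset.univ.filter fun q : Fin n × Fin n => q.1 < q.2).erase (a, b),
        pairInv (w q.1) (w q.2) =
      ∑ q ∈ (Finset.univ.filter fun q : Fin n × Fin n => q.1 < q.2).erase (a, b),
        pairInv (w' q.1) (w' q.2) from ?_]
  · omega
  have key : ∀ q ∈ (Finset.univ.filter fun q : Fin n × Fin n => q.1 < q.2).erase (a, b),
      (Equiv.swap a b q.1, Equiv.swap a b q.2) ∈
        (Finset.univ.filter fun q : Fin n × Fin n => q.1 < q.2).erase (a, b) := by
    rintro ⟨i, j⟩ hq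
    simp only [Finset.mem_erase, Finset.mem_filter, Finset.mem_univ, true_and] at hq ⊢
    refine ⟨fun hc => ?_, swap_lt_swap hab hq.2 hq.1⟩
    simp only [Prod.mk.injEq, Equiv.swap_apply_eq_iff, Equiv.swap_apply_left,
      Equiv.swap_apply_right] at hc
    have := hq.2
    rw [hc.1, hc.2] at this
    exact absurd this hlt.not_gt
  refine Finset.sum_nbij' (fun q => (Equiv.swap a b q.1, Equiv.swap a b q.2))
    (fun q => (Equiv.swap a b q.1, Equiv.swap a b q.2)) key key ?_ ?_ ?_
  · intro q _; simp
  · intro q _; simp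
  · rintro ⟨i, j⟩ hq
    simp only [Finset.mem_erase, Finset.mem_filter, Finset.mem_univ, true_and] at hq
    exact (h i j hq.2 hq.1).symm

lemma pairInv_neg_left (x y : ℤ) : pairInv (-x) y = pairInv x y := by
  unfold pairInv
  split_ifs <;> omega

lemma pairInv_lt_swap {x y : ℤ} : pairInv x y < pairInv y x ↔ x < y := by
  unfold pairInv
  split_ifs <;> omega

lemma pairInv_lt_neg_swap {x y : ℤ} : pairInv x y < pairInv (-y) (-x) ↔ 0 < x + y := by
  unfold pairInv
  split_ifs <;> omega

lemma simpleReflection_succ_apply {n k : ℕ} (hk : k + 1 < n) (x : SignedIndex n) :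
    (simpleReflection n (k + 1) x : ℤ) =
      if (x : ℤ) = k + 1 then (k : ℤ) + 2 else if (x : ℤ) = k + 2 then (k : ℤ) + 1 else
      if (x : ℤ) = -(k + 1) then -((k : ℤ) + 2) else
      if (x : ℤ) = -(k + 2) then -((k : ℤ) + 1) else x := by
  rw [simpleReflection, dif_pos ⟨hk, by omega⟩, dif_neg (by omega), Equiv.Perm.mul_apply]
  simp only [Equiv.swap_apply_def, Subtype.ext_iff, point, apply_ite Subtype.val]
  push_cast
  split_ifs <;> omega

lemma simpleReflection_zero_apply {n : ℕ} (hn : 2 ≤ n) (x : SignedIndex n) :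
    (simpleReflection n 0 x : ℤ) =
      if (x : ℤ) = 1 then (-2 : ℤ) else if (x : ℤ) = 2 then -1 else
      if (x : ℤ) = -1 then 2 else if (x : ℤ) = -2 then 1 else x := by
  rw [simpleReflection, dif_pos ⟨by omega, by omega⟩, dif_pos rfl, Equiv.Perm.mul_apply]
  simp only [Equiv.swap_apply_def, Subtype.ext_iff, point, apply_ite Subtype.val]
  split_ifs <;> first | contradiction | omega

lemma isSigned_simpleReflection {n k : ℕ} (hn : 2 ≤ n) (hk : k < n) :
    IsSigned (simpleReflection n k) := by
  intro i j h
  cases k with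
  | zero =>
    rw [simpleReflection_zero_apply hn, simpleReflection_zero_apply hn, h]
    split_ifs <;> omega
  | succ k =>
    rw [simpleReflection_succ_apply hk, simpleReflection_succ_apply hk, h]
    split_ifs <;> omega

lemma IsSigned.mul {n : ℕ} {σ τ : Equiv.Perm (SignedIndex n)} (hσ : IsSigned σ)
    (hτ : IsSigned τ) : IsSigned (σ * τ) := fun i j h => hσ _ _ (hτ i j h)

lemma window_mul_succ {n k : ℕ} (σ : Equiv.Perm (SignedIndex n)) (hk : k + 1 < n) (i : Fin n) :
    window (σ * simpleReflection n (k + 1)) i =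
      window σ (Equiv.swap ⟨k, by omega⟩ ⟨k + 1, hk⟩ i) := by
  rw [window, window, Equiv.Perm.mul_apply]
  congr 2
  rw [Subtype.ext_iff, simpleReflection_succ_apply hk]
  simp only [Equiv.swap_apply_def, posPoint, point, Fin.ext_iff, apply_ite Fin.val]
  split_ifs <;> push_cast <;> omega

lemma window_mul_zero {n : ℕ} {σ : Equiv.Perm (SignedIndex n)} (hσ : IsSigned σ) (hn : 2 ≤ n)
    (i : Fin n) :
    window (σ * simpleReflection n 0) i = if (i : ℕ) < 2 then
      -window σ (Equiv.swap ⟨0, by omega⟩ ⟨1, by omega⟩ i) else window σ i := by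
  rw [window, Equiv.Perm.mul_apply]
  split_ifs with hi
  · rw [← hσ.apply_negPoint]
    congr 2
    rw [Subtype.ext_iff, simpleReflection_zero_apply hn]
    simp only [Equiv.swap_apply_def, posPoint, negPoint, point, Fin.ext_iff, apply_ite Fin.val]
    split_ifs <;> push_cast <;> omega
  · rw [window]
    congr 2
    rw [Subtype.ext_iff, simpleReflection_zero_apply hn]
    simp only [posPoint, point]
    split_ifs <;> omega

theorem len_lt_mul_succ {n k : ℕ} {σ : Equiv.Perm (SignedIndex n)} (hσ : IsSigned σ)
    (hk : k + 1 < n) :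
    len σ < len (σ * simpleReflection n (k + 1)) ↔
      window σ ⟨k, by omega⟩ < window σ ⟨k + 1, hk⟩ := by
  rw [len_eq hσ, len_eq (hσ.mul (isSigned_simpleReflection (by omega) hk))]
  refine (pairSum_lt_iff _ _ (a := ⟨k, by omega⟩) (b := ⟨k + 1, hk⟩) rfl ?_).trans ?_
  · intro i j _ _
    rw [window_mul_succ σ hk, window_mul_succ σ hk, Equiv.swap_apply_self, Equiv.swap_apply_self]
  · rw [window_mul_succ σ hk, window_mul_succ σ hk, Equiv.swap_apply_left, Equiv.swap_apply_right,
      pairInv_lt_swap]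

/-- Besides swapping the first two entries, `s_0` negates them. Against later positions this is
invisible, because `pairInv` ignores the sign of its first argument. -/
theorem len_lt_mul_zero {n : ℕ} {σ : Equiv.Perm (SignedIndex n)} (hσ : IsSigned σ)
    (hn : 2 ≤ n) :
    len σ < len (σ * simpleReflection n 0) ↔
      0 < window σ ⟨0, by omega⟩ + window σ ⟨1, by omega⟩ := by
  rw [len_eq hσ, len_eq (hσ.mul (isSigned_simpleReflection hn (by omega)))]
  refine (pairSum_lt_iff _ _ (a := ⟨0, by omega⟩) (b := ⟨1, by omega⟩) rfl ?_).trans ?_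
  · intro i j hij hne
    simp only [ne_eq, Prod.mk.injEq, Fin.ext_iff, Fin.lt_def] at hij hne
    -- Every increasing pair other than `(0, 1)` has `j ≥ 2`.
    have hj : Equiv.swap (⟨0, by omega⟩ : Fin n) ⟨1, by omega⟩ j = j :=
      Equiv.swap_apply_of_ne_of_ne (by rw [ne_eq, Fin.ext_iff]; simp only; omega)
        (by rw [ne_eq, Fin.ext_iff]; simp only; omega)
    rw [hj, window_mul_zero hσ hn j, if_neg (by omega), window_mul_zero hσ hn,
      Equiv.swap_apply_self]
    split_ifs with h
    · rw [pairInv_neg_left]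
    · congr 2
      refine Equiv.swap_apply_of_ne_of_ne ?_ ?_ <;> rintro rfl <;> simp at h
  · rw [window_mul_zero hσ hn, window_mul_zero hσ hn, if_pos (by simp), if_pos (by simp),
      Equiv.swap_apply_left, Equiv.swap_apply_right, pairInv_lt_neg_swap]

/-! ### Pairs of blocks and removal of the largest absolute value. -/

/-- `u` and `v` are increasing, `u` is positive, and the absolute values of their entries are
distinct elements of `{1, …, N}`. -/
structure IsSplit {r k : ℕ} (N : ℤ) (u : Fin r → ℤ) (v : Fin k → ℤ) : Prop where
  u_mono : StrictMono u
  v_mono : StrictMono v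
  u_pos : ∀ i, 0 < u i
  u_le : ∀ i, u i ≤ N
  v_ne : ∀ j, v j ≠ 0
  v_le : ∀ j, |v j| ≤ N
  v_inj : ∀ j j', |v j| = |v j'| → j = j'
  disj : ∀ i j, u i ≠ |v j|

open Classical in
/-- The pairs of increasing sequences of lengths `r` and `k` whose absolute values exhaust
`{1, …, r + k}`, the first one being positive. -/
def splits (r k : ℕ) : Finset ((Fin r → ℤ) × (Fin k → ℤ)) :=
  (Fintype.piFinset (fun _ : Fin r => Finset.Icc (1 : ℤ) ((r + k : ℕ) : ℤ)) ×ˢ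
    Fintype.piFinset (fun _ : Fin k => Finset.Icc (-((r + k : ℕ) : ℤ)) ((r + k : ℕ) : ℤ))).filter
      fun p => IsSplit ((r + k : ℕ) : ℤ) p.1 p.2

lemma mem_splits {r k : ℕ} {p : (Fin r → ℤ) × (Fin k → ℤ)} :
    p ∈ splits r k ↔ IsSplit ((r + k : ℕ) : ℤ) p.1 p.2 := by
  simp only [splits, Finset.mem_filter, Finset.mem_product, Fintype.mem_piFinset, Finset.mem_Icc,
    and_iff_right_iff_imp]
  exact fun h => ⟨fun i => ⟨h.u_pos i, h.u_le i⟩, fun j => abs_le.mp (h.v_le j)⟩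

lemma strictMono_snoc {r : ℕ} {u : Fin r → ℤ} {N : ℤ} (hu : StrictMono u) (h : ∀ i, u i < N) :
    StrictMono (Fin.snoc (α := fun _ => ℤ) u N) := by
  intro i j
  refine Fin.lastCases ?_ (fun i => ?_) i <;> refine Fin.lastCases ?_ (fun j => ?_) j
  · simp
  · intro hij; exact absurd hij (Fin.castSucc_lt_last j).not_gt
  · intro _; simpa using h i
  · intro hij; simpa using hu (Fin.castSucc_lt_castSucc_iff.mp hij)

lemma strictMono_cons {r : ℕ} {u : Fin r → ℤ} {N : ℤ} (hu : StrictMono u) (h : ∀ i, N < u i) :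
    StrictMono (Fin.cons (α := fun _ => ℤ) N u) := by
  intro i j
  refine Fin.cases ?_ (fun i => ?_) i <;> refine Fin.cases ?_ (fun j => ?_) j
  · simp
  · intro _; simpa using h j
  · intro hij; simp at hij
  · intro hij; simpa using hu (Fin.succ_lt_succ_iff.mp hij)

/-- Pigeonhole: the `r + k` distinct absolute values lie in `{1, …, r + k}` and hence fill it. -/
lemma IsSplit.exists_abs_eq {r k : ℕ} {u : Fin r → ℤ} {v : Fin k → ℤ}
    (h : IsSplit ((r + k : ℕ) : ℤ) u v) (hN : 0 < r + k) :
    (∃ i, u i = ((r + k : ℕ) : ℤ)) ∨ (∃ j, v j = ((r + k : ℕ) : ℤ)) ∨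
      ∃ j, v j = -((r + k : ℕ) : ℤ) := by
  let f : Fin r ⊕ Fin k → ℤ := Sum.elim u fun j => |v j|
  have hf : Function.Injective f := by
    rintro (i | i) (j | j) hij
    · exact congrArg _ (h.u_mono.injective hij)
    · exact absurd hij (h.disj _ _)
    · exact absurd hij.symm (h.disj _ _)
    · exact congrArg _ (h.v_inj _ _ hij)
  have hsub : Finset.univ.image f ⊆ Finset.Icc (1 : ℤ) ((r + k : ℕ) : ℤ) := by
    intro x hx
    obtain ⟨i | j, -, rfl⟩ := Finset.mem_image.mp hx
    · exact Finset.mem_Icc.mpr ⟨h.u_pos i, h.u_le i⟩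
    · exact Finset.mem_Icc.mpr ⟨Int.one_le_abs (h.v_ne j), h.v_le j⟩
  have heq := Finset.eq_of_subset_of_card_le hsub (by
    rw [Finset.card_image_of_injective _ hf]; simp)
  have hmem : ((r + k : ℕ) : ℤ) ∈ Finset.univ.image f := by
    rw [heq, Finset.mem_Icc]; omega
  obtain ⟨i | j, -, hj⟩ := Finset.mem_image.mp hmem
  · exact .inl ⟨i, hj⟩
  · rcases eq_or_eq_neg_of_abs_eq hj with h' | h'
    · exact .inr (.inl ⟨j, h'⟩)
    · exact .inr (.inr ⟨j, h'⟩)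

section Recursion

variable {R : Type*} [AddCommMonoid R]

open Classical in
lemma sum_splits {r k : ℕ} (hN : 0 < r + k) (φ : (Fin r → ℤ) × (Fin k → ℤ) → R) :
    ∑ p ∈ splits r k, φ p =
      ∑ p ∈ (splits r k).filter (fun p => ∃ i, p.1 i = ((r + k : ℕ) : ℤ)), φ p +
      ∑ p ∈ (splits r k).filter (fun p => ∃ j, p.2 j = ((r + k : ℕ) : ℤ)), φ p +
      ∑ p ∈ (splits r k).filter (fun p => ∃ j, p.2 j = -((r + k : ℕ) : ℤ)), φ p := by
  rw [← Finset.sum_union, ← Finset.sum_union]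
  · refine Finset.sum_congr ?_ fun _ _ => rfl
    ext p
    simp only [Finset.mem_union, Finset.mem_filter, ← and_or_left, or_assoc]
    exact ⟨fun hp => ⟨hp, (mem_splits.mp hp).exists_abs_eq hN⟩, fun hp => hp.1⟩
  · rw [Finset.disjoint_left]
    simp only [Finset.mem_union, Finset.mem_filter]
    rintro p (⟨hp, i, hi⟩ | ⟨hp, i, hi⟩) ⟨-, j, hj⟩
    · refine (mem_splits.mp hp).disj i j ?_
      rw [hi, hj, abs_neg, Nat.abs_cast]
    · have := (mem_splits.mp hp).v_inj i j (by rw [hi, hj, abs_neg])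
      subst this
      omega
  · rw [Finset.disjoint_left]
    simp only [Finset.mem_filter]
    rintro p ⟨hp, i, hi⟩ ⟨-, j, hj⟩
    refine (mem_splits.mp hp).disj i j ?_
    rw [hi, hj, Nat.abs_cast]

open Classical in
-- Monotonicity forces the maximum to be the last entry, so deleting it inverts `Fin.snoc`. The two
-- lemmas after this one treat `v` in the same way; there `-N` must be the first entry and is
-- inserted by `Fin.cons`.
lemma sum_splits_left {r k : ℕ} (φ : (Fin (r + 1) → ℤ) × (Fin k → ℤ) → R) :
    ∑ p ∈ (splits (r + 1) k).filter (fun p => ∃ i, p.1 i = ((r + 1 + k : ℕ) : ℤ)), φ p =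
      ∑ p ∈ splits r k, φ (Fin.snoc (α := fun _ => ℤ) p.1 ((r + 1 + k : ℕ) : ℤ), p.2) := by
  symm
  refine Finset.sum_bij' (fun p _ => (Fin.snoc (α := fun _ => ℤ) p.1 ((r + 1 + k : ℕ) : ℤ), p.2))
    (fun p _ => (Fin.init p.1, p.2)) ?_ ?_ ?_ ?_ (fun _ _ => rfl)
  · rintro ⟨u, v⟩ hp
    have h := mem_splits.mp hp
    simp only at h
    simp only [Finset.mem_filter, mem_splits]
    refine ⟨⟨strictMono_snoc h.u_mono fun i => ?_, h.v_mono, ?_, ?_, h.v_ne, fun j => ?_, h.v_inj,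
      ?_⟩, Fin.last r, by simp⟩
    · have := h.u_le i; omega
    · refine Fin.lastCases ?_ fun i => ?_
      · simp only [Fin.snoc_last]; omega
      · simpa using h.u_pos i
    · refine Fin.lastCases ?_ fun i => ?_
      · simp
      · have := h.u_le i; simp only [Fin.snoc_castSucc]; omega
    · have := h.v_le j; omega
    · refine Fin.lastCases (fun j => ?_) fun i j => ?_
      · have := h.v_le j; simp only [Fin.snoc_last]; omega
      · simpa using h.disj i j
  · rintro ⟨u, v⟩ hp
    simp only [Finset.mem_filter, mem_splits] at hp
    obtain ⟨h, i, hi⟩ := hp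
    have hlast : ∀ i : Fin r, u i.castSucc < ((r + 1 + k : ℕ) : ℤ) := fun i =>
      (h.u_mono (Fin.castSucc_lt_last i)).trans_le (h.u_le _)
    rw [mem_splits]
    refine ⟨fun i j hij => h.u_mono (by simpa using hij), h.v_mono, fun i => h.u_pos _,
      fun i => ?_, h.v_ne, fun j => ?_, h.v_inj, fun i j => h.disj _ j⟩
    · have := hlast i; simp only [Fin.init]; omega
    · have h1 := h.v_le j
      have h2 := h.disj i j
      simp only; omega
  · rintro ⟨u, v⟩ _; simp
  · rintro ⟨u, v⟩ hp
    simp only [Finset.mem_filter, mem_splits] at hp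
    obtain ⟨h, i, hi⟩ := hp
    have h1 : u (Fin.last r) = ((r + 1 + k : ℕ) : ℤ) :=
      le_antisymm (h.u_le _) (hi ▸ h.u_mono.monotone (Fin.le_last i))
    simp only [Prod.mk.injEq, and_true]
    rw [← h1, Fin.snoc_init_self]

open Classical in
lemma sum_splits_right {r k : ℕ} (φ : (Fin r → ℤ) × (Fin (k + 1) → ℤ) → R) :
    ∑ p ∈ (splits r (k + 1)).filter (fun p => ∃ i, p.2 i = ((r + (k + 1) : ℕ) : ℤ)), φ p =
      ∑ p ∈ splits r k, φ (p.1, Fin.snoc (α := fun _ => ℤ) p.2 ((r + (k + 1) : ℕ) : ℤ)) := by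
  symm
  refine Finset.sum_bij'
    (fun p _ => (p.1, Fin.snoc (α := fun _ => ℤ) p.2 ((r + (k + 1) : ℕ) : ℤ)))
    (fun p _ => (p.1, Fin.init p.2)) ?_ ?_ ?_ ?_ (fun _ _ => rfl)
  · rintro ⟨u, v⟩ hp
    have h := mem_splits.mp hp
    simp only at h
    simp only [Finset.mem_filter, mem_splits]
    refine ⟨⟨h.u_mono, strictMono_snoc h.v_mono fun i => ?_, h.u_pos, fun i => ?_, ?_, ?_, ?_, ?_⟩,
      Fin.last k, by simp⟩
    · have := (le_abs_self _).trans (h.v_le i); omega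
    · have := h.u_le i; omega
    · refine Fin.lastCases ?_ fun i => ?_
      · simp only [Fin.snoc_last]; omega
      · simpa using h.v_ne i
    · refine Fin.lastCases ?_ fun i => ?_
      · simp only [Fin.snoc_last, Nat.abs_cast]; rfl
      · have := h.v_le i; simp only [Fin.snoc_castSucc]; omega
    · refine Fin.lastCases (Fin.lastCases (fun _ => rfl) fun i hi => ?_)
        fun i => Fin.lastCases (fun hi => ?_) fun j hij => ?_
      · have := h.v_le i
        simp only [Fin.snoc_last, Fin.snoc_castSucc, Nat.abs_cast] at hi; omega
      · have := h.v_le i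
        simp only [Fin.snoc_last, Fin.snoc_castSucc, Nat.abs_cast] at hi; omega
      · rw [h.v_inj i j (by simpa using hij)]
    · intro i
      refine Fin.lastCases ?_ fun j => ?_
      · have := h.u_le i; simp only [Fin.snoc_last, Nat.abs_cast]; omega
      · simpa using h.disj i j
  · rintro ⟨u, v⟩ hp
    simp only [Finset.mem_filter, mem_splits] at hp
    obtain ⟨h, i, hi⟩ := hp
    have h1 : v (Fin.last k) = ((r + (k + 1) : ℕ) : ℤ) :=
      le_antisymm ((le_abs_self _).trans (h.v_le _)) (hi ▸ h.v_mono.monotone (Fin.le_last i))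
    rw [mem_splits]
    refine ⟨h.u_mono, fun i j hij => h.v_mono (by simpa using hij), h.u_pos, fun i => ?_,
      fun j => h.v_ne _, fun j => ?_, fun i j hij => Fin.castSucc_injective _ (h.v_inj _ _ hij),
      fun i j => h.disj i _⟩
    · have h2 := h.u_le i
      have h3 := h.disj i (Fin.last k)
      rw [h1, Nat.abs_cast] at h3
      simp only; omega
    · have h2 := h.v_le j.castSucc
      have h3 : |v j.castSucc| ≠ |v (Fin.last k)| := fun hc =>
        (Fin.castSucc_lt_last j).ne (h.v_inj _ _ hc)
      rw [h1, Nat.abs_cast] at h3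
      simp only [Fin.init]; omega
  · rintro ⟨u, v⟩ _; simp
  · rintro ⟨u, v⟩ hp
    simp only [Finset.mem_filter, mem_splits] at hp
    obtain ⟨h, i, hi⟩ := hp
    have h1 : v (Fin.last k) = ((r + (k + 1) : ℕ) : ℤ) :=
      le_antisymm ((le_abs_self _).trans (h.v_le _)) (hi ▸ h.v_mono.monotone (Fin.le_last i))
    simp only [Prod.mk.injEq, true_and]
    rw [← h1, Fin.snoc_init_self]

open Classical in
lemma sum_splits_right_neg {r k : ℕ} (φ : (Fin r → ℤ) × (Fin (k + 1) → ℤ) → R) :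
    ∑ p ∈ (splits r (k + 1)).filter (fun p => ∃ i, p.2 i = -((r + (k + 1) : ℕ) : ℤ)), φ p =
      ∑ p ∈ splits r k, φ (p.1, Fin.cons (α := fun _ => ℤ) (-((r + (k + 1) : ℕ) : ℤ)) p.2) := by
  symm
  refine Finset.sum_bij'
    (fun p _ => (p.1, Fin.cons (α := fun _ => ℤ) (-((r + (k + 1) : ℕ) : ℤ)) p.2))
    (fun p _ => (p.1, Fin.tail p.2)) ?_ ?_ ?_ ?_ (fun _ _ => rfl)
  · rintro ⟨u, v⟩ hp
    have h := mem_splits.mp hp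
    simp only at h
    simp only [Finset.mem_filter, mem_splits]
    refine ⟨⟨h.u_mono, strictMono_cons h.v_mono fun i => ?_, h.u_pos, fun i => ?_, ?_, ?_, ?_, ?_⟩,
      0, by simp⟩
    · have := (neg_le_abs _).trans (h.v_le i); omega
    · have := h.u_le i; omega
    · refine Fin.cases ?_ fun i => ?_
      · simp only [Fin.cons_zero]; omega
      · simpa using h.v_ne i
    · refine Fin.cases ?_ fun i => ?_
      · simp only [Fin.cons_zero, abs_neg, Nat.abs_cast]; rfl
      · have := h.v_le i; simp only [Fin.cons_succ]; omega
    · refine Fin.cases (Fin.cases (fun _ => rfl) fun i hi => ?_)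
        fun i => Fin.cases (fun hi => ?_) fun j hij => ?_
      · have := h.v_le i
        simp only [Fin.cons_zero, Fin.cons_succ, abs_neg, Nat.abs_cast] at hi; omega
      · have := h.v_le i
        simp only [Fin.cons_zero, Fin.cons_succ, abs_neg, Nat.abs_cast] at hi; omega
      · rw [h.v_inj i j (by simpa using hij)]
    · intro i
      refine Fin.cases ?_ fun j => ?_
      · have := h.u_le i; simp only [Fin.cons_zero, abs_neg, Nat.abs_cast]; omega
      · simpa using h.disj i j
  · rintro ⟨u, v⟩ hp
    simp only [Finset.mem_filter, mem_splits] at hp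
    obtain ⟨h, i, hi⟩ := hp
    have h1 : v 0 = -((r + (k + 1) : ℕ) : ℤ) :=
      le_antisymm (hi ▸ h.v_mono.monotone (Fin.zero_le i)) (abs_le.mp (h.v_le _)).1
    rw [mem_splits]
    refine ⟨h.u_mono, fun i j hij => h.v_mono (by simpa using hij), h.u_pos, fun i => ?_,
      fun j => h.v_ne _, fun j => ?_, fun i j hij => Fin.succ_injective _ (h.v_inj _ _ hij),
      fun i j => h.disj i _⟩
    · have h2 := h.u_le i
      have h3 := h.disj i 0
      rw [h1, abs_neg, Nat.abs_cast] at h3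
      simp only; omega
    · have h2 := h.v_le j.succ
      have h3 : |v j.succ| ≠ |v 0| := fun hc => (Fin.succ_ne_zero j) (h.v_inj _ _ hc)
      rw [h1, abs_neg, Nat.abs_cast] at h3
      simp only [Fin.tail]; omega
  · rintro ⟨u, v⟩ _; simp
  · rintro ⟨u, v⟩ hp
    simp only [Finset.mem_filter, mem_splits] at hp
    obtain ⟨h, i, hi⟩ := hp
    have h1 : v 0 = -((r + (k + 1) : ℕ) : ℤ) :=
      le_antisymm (hi ▸ h.v_mono.monotone (Fin.zero_le i)) (abs_le.mp (h.v_le _)).1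
    simp only [Prod.mk.injEq, true_and]
    rw [← h1, Fin.cons_self_tail]

theorem sum_splits_succ_succ {r k : ℕ} (φ : (Fin (r + 1) → ℤ) × (Fin (k + 1) → ℤ) → R) :
    ∑ p ∈ splits (r + 1) (k + 1), φ p =
      ∑ p ∈ splits r (k + 1),
        φ (Fin.snoc (α := fun _ => ℤ) p.1 ((r + 1 + (k + 1) : ℕ) : ℤ), p.2) +
      ∑ p ∈ splits (r + 1) k,
        φ (p.1, Fin.snoc (α := fun _ => ℤ) p.2 ((r + 1 + (k + 1) : ℕ) : ℤ)) +
      ∑ p ∈ splits (r + 1) k,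
        φ (p.1, Fin.cons (α := fun _ => ℤ) (-((r + 1 + (k + 1) : ℕ) : ℤ)) p.2) := by
  classical
  rw [sum_splits (by omega), sum_splits_left, sum_splits_right, sum_splits_right_neg]

theorem sum_splits_zero_succ {k : ℕ} (φ : (Fin 0 → ℤ) × (Fin (k + 1) → ℤ) → R) :
    ∑ p ∈ splits 0 (k + 1), φ p =
      ∑ p ∈ splits 0 k, φ (p.1, Fin.snoc (α := fun _ => ℤ) p.2 ((0 + (k + 1) : ℕ) : ℤ)) +
      ∑ p ∈ splits 0 k,
        φ (p.1, Fin.cons (α := fun _ => ℤ) (-((0 + (k + 1) : ℕ) : ℤ)) p.2) := by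
  classical
  rw [sum_splits (by omega), sum_splits_right, sum_splits_right_neg]
  simp

theorem sum_splits_succ_zero {r : ℕ} (φ : (Fin (r + 1) → ℤ) × (Fin 0 → ℤ) → R) :
    ∑ p ∈ splits (r + 1) 0, φ p =
      ∑ p ∈ splits r 0, φ (Fin.snoc (α := fun _ => ℤ) p.1 ((r + 1 + 0 : ℕ) : ℤ), p.2) := by
  classical
  rw [sum_splits (by omega), sum_splits_left]
  simp

end Recursion

lemma splits_zero_zero : splits 0 0 = {(Fin.elim0, Fin.elim0)} := by
  ext p
  rw [mem_splits, Finset.mem_singleton]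
  refine ⟨fun _ => Subsingleton.elim _ _, fun _ => ?_⟩
  constructor <;> intro i <;> exact i.elim0

/-! ### Effect of the largest entry on the inversion counts. -/

/-- The weighted number of inversions between `u` and `v` and inside `v`. -/
def blockSum (c d : ℕ → ℕ → ℕ) {r k : ℕ} (u : Fin r → ℤ) (v : Fin k → ℤ) : ℕ :=
  (∑ i : Fin r, ∑ j : Fin k, c i j * pairInv (u i) (v j)) +
    ∑ j : Fin k, ∑ j' : Fin k, if j < j' then d j j' * pairInv (v j) (v j') else 0

/-- An entry dominating in absolute value contributes a constant: `0` as a positive right entry, `2`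
as a negative right entry, and `1` on the left with either sign. -/
lemma pairInv_of_abs_lt {x N : ℤ} (h : |x| < N) : pairInv x N = 0 := by
  rw [abs_lt] at h
  unfold pairInv
  split_ifs <;> omega

lemma pairInv_neg_of_abs_lt {x N : ℤ} (h : |x| < N) : pairInv x (-N) = 2 := by
  rw [abs_lt] at h
  unfold pairInv
  split_ifs <;> omega

lemma pairInv_of_lt_abs {x N : ℤ} (h : |x| < |N|) : pairInv N x = 1 := by
  rw [abs_lt] at h
  unfold pairInv
  rcases abs_choice N with h' | h' <;> rw [h'] at h <;> split_ifs <;> omega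

section BlockSum

variable (c d : ℕ → ℕ → ℕ) {r k : ℕ} {u : Fin r → ℤ} {v : Fin k → ℤ} {N : ℤ}

lemma blockSum_snoc_left (hN : 0 ≤ N) (hv : ∀ j, |v j| < N) :
    blockSum c d (Fin.snoc (α := fun _ => ℤ) u N) v = blockSum c d u v + ∑ j : Fin k, c r j := by
  have h : ∀ j, pairInv N (v j) = 1 := fun j => pairInv_of_lt_abs (by
    rw [abs_of_nonneg hN]; exact hv j)
  simp only [blockSum, Fin.sum_univ_castSucc, Fin.snoc_castSucc, Fin.snoc_last, h, mul_one,
    Fin.val_castSucc, Fin.val_last]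
  ring

lemma blockSum_snoc_right (hu : ∀ i, |u i| < N) (hv : ∀ j, |v j| < N) :
    blockSum c d u (Fin.snoc (α := fun _ => ℤ) v N) = blockSum c d u v := by
  have h : ∀ j : Fin k, ¬ Fin.last k < j.castSucc := fun j => (Fin.castSucc_lt_last j).not_gt
  simp only [blockSum, Fin.sum_univ_castSucc, Fin.snoc_castSucc, Fin.snoc_last,
    pairInv_of_abs_lt (hu _), pairInv_of_abs_lt (hv _), mul_zero, Fin.val_castSucc, Fin.val_last,
    add_zero, ite_self, h, if_false, lt_irrefl, Finset.sum_const_zero,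
    Fin.castSucc_lt_castSucc_iff]

/-- The new entry is inverted twice with each `u i` and once with each `v j`. The old entries of `v`
move one place to the right, hence the shifted weights. -/
lemma blockSum_cons_right (hu : ∀ i, |u i| < N) (hv : ∀ j, |v j| < N) (hN : 0 ≤ N) :
    blockSum c d u (Fin.cons (α := fun _ => ℤ) (-N) v) =
      blockSum (fun i j => c i (j + 1)) (fun i j => d (i + 1) (j + 1)) u v +
      2 * ∑ i : Fin r, c i 0 + ∑ j : Fin k, d 0 (j + 1) := by
  have h : ∀ j, pairInv (-N) (v j) = 1 := fun j => pairInv_of_lt_abs (by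
    rw [abs_neg, abs_of_nonneg hN]; exact hv j)
  simp only [blockSum, Fin.sum_univ_succ, Fin.cons_zero, Fin.cons_succ,
    pairInv_neg_of_abs_lt (hu _), h, mul_one, Fin.val_succ, Fin.val_zero, if_false,
    Fin.succ_pos, if_true, zero_add, Fin.not_lt_zero, Fin.succ_lt_succ_iff,
    Finset.sum_add_distrib, ← Finset.sum_mul]
  ring

end BlockSum

/-- The contribution to the odd length of an element of a quotient with blocks `u` and `v`, when
the (zero-based) position of the first entry of `v` is congruent to `b` modulo `2`. -/
def oddBlockSum (b : ℕ) {r k : ℕ} (u : Fin r → ℤ) (v : Fin k → ℤ) : ℕ :=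
  blockSum (fun i j => (i + b + j) % 2) (fun i j => (i + j) % 2) u v

lemma oddBlockSum_add_two (b : ℕ) {r k : ℕ} (u : Fin r → ℤ) (v : Fin k → ℤ) :
    oddBlockSum (b + 2) u v = oddBlockSum b u v := by
  simp only [oddBlockSum]
  congr 1
  funext i j
  omega

lemma sum_mod_two (b r : ℕ) : ∑ i : Fin r, ((i : ℕ) + b) % 2 = (r + b % 2) / 2 := by
  induction r with
  | zero => simp only [Finset.univ_eq_empty, Finset.sum_empty]; omega
  | succ r ih =>
    rw [Fin.sum_univ_castSucc]
    simp only [Fin.val_castSucc, Fin.val_last, ih]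
    omega

/-! ### The signed generating function of block pairs and its recursion. -/

section Weight

variable {R : Type*} [CommRing R] (x : R)

/-- The sum of `(-1)^ℓ x^L` over the pairs of blocks of lengths `r` and `k`. -/
def splitSum (r k b : ℕ) : R :=
  ∑ p ∈ splits r k, (-1) ^ blockSum (fun _ _ => 1) (fun _ _ => 1) p.1 p.2 *
    x ^ oddBlockSum b p.1 p.2

lemma splitSum_add_two (r k b : ℕ) : splitSum x r k (b + 2) = splitSum x r k b := by
  simp only [splitSum, oddBlockSum_add_two]

lemma splitSum_zero (r b : ℕ) : splitSum x r 0 b = 1 := by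
  induction r with
  | zero => simp [splitSum, splits_zero_zero, blockSum, oddBlockSum]
  | succ r ih =>
    rw [← ih, splitSum, splitSum, sum_splits_succ_zero]
    simp [blockSum, oddBlockSum]

lemma IsSplit.abs_u_lt {r k : ℕ} {u : Fin r → ℤ} {v : Fin k → ℤ} {N M : ℤ} (h : IsSplit N u v)
    (hM : N < M) (i : Fin r) : |u i| < M := by
  rw [abs_of_pos (h.u_pos i)]
  exact (h.u_le i).trans_lt hM

lemma splitSum_snoc_right (r k b : ℕ) :
    ∑ p ∈ splits r k, (-1) ^ blockSum (fun _ _ => 1) (fun _ _ => 1) p.1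
        (Fin.snoc (α := fun _ => ℤ) p.2 ((r + (k + 1) : ℕ) : ℤ)) *
      x ^ oddBlockSum b p.1 (Fin.snoc (α := fun _ => ℤ) p.2 ((r + (k + 1) : ℕ) : ℤ)) =
    splitSum x r k b := by
  refine Finset.sum_congr rfl fun p hp => ?_
  have h := mem_splits.mp hp
  have hN : ((r + k : ℕ) : ℤ) < ((r + (k + 1) : ℕ) : ℤ) := by omega
  rw [oddBlockSum, blockSum_snoc_right _ _ (h.abs_u_lt hN) (fun j => (h.v_le j).trans_lt hN),
    blockSum_snoc_right _ _ (h.abs_u_lt hN) (fun j => (h.v_le j).trans_lt hN), oddBlockSum]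

/-- Only pairs of opposite parity count in the exponent: `(r + b % 2) / 2` positions of `u`, each
counted twice, and `(k + 1) / 2` positions of `v`. In the sign the even contribution of `u`
disappears. -/
lemma splitSum_cons_right (r k b : ℕ) :
    ∑ p ∈ splits r k, (-1) ^ blockSum (fun _ _ => 1) (fun _ _ => 1) p.1
        (Fin.cons (α := fun _ => ℤ) (-((r + (k + 1) : ℕ) : ℤ)) p.2) *
      x ^ oddBlockSum b p.1 (Fin.cons (α := fun _ => ℤ) (-((r + (k + 1) : ℕ) : ℤ)) p.2) =
    (-1) ^ k * x ^ (2 * ((r + b % 2) / 2) + (k + 1) / 2) * splitSum x r k (b + 1) := by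
  rw [splitSum, Finset.mul_sum]
  refine Finset.sum_congr rfl fun p hp => ?_
  have h := mem_splits.mp hp
  have hN : ((r + k : ℕ) : ℤ) < ((r + (k + 1) : ℕ) : ℤ) := by omega
  rw [oddBlockSum, blockSum_cons_right _ _ (h.abs_u_lt hN) (fun j => (h.v_le j).trans_lt hN)
      (by omega),
    blockSum_cons_right _ _ (h.abs_u_lt hN) (fun j => (h.v_le j).trans_lt hN) (by omega)]
  -- The shift changes the parity of `v` relative to `u`, but not the parities inside `v`.
  have h1 : blockSum (fun i j => (i + b + (j + 1)) % 2) (fun i j => (i + 1 + (j + 1)) % 2) p.1 p.2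
      = oddBlockSum (b + 1) p.1 p.2 := by
    rw [oddBlockSum]
    congr 1 <;> funext i j <;> omega
  have h2 : ∑ i : Fin r, ((i : ℕ) + b + 0) % 2 = (r + b % 2) / 2 := by
    simpa using sum_mod_two b r
  have h3 : ∑ j : Fin k, (0 + ((j : ℕ) + 1)) % 2 = (k + 1) / 2 := by
    simpa using sum_mod_two 1 k
  rw [h1, h2, h3]
  simp only [Finset.sum_const, Finset.card_univ, Fintype.card_fin, smul_eq_mul, mul_one, pow_add,
    pow_mul]
  norm_num
  ring

lemma splitSum_snoc_left (r k b : ℕ) :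
    ∑ p ∈ splits r k, (-1) ^ blockSum (fun _ _ => 1) (fun _ _ => 1)
        (Fin.snoc (α := fun _ => ℤ) p.1 ((r + 1 + k : ℕ) : ℤ)) p.2 *
      x ^ oddBlockSum b (Fin.snoc (α := fun _ => ℤ) p.1 ((r + 1 + k : ℕ) : ℤ)) p.2 =
    (-1) ^ k * x ^ ((k + (r + b) % 2) / 2) * splitSum x r k b := by
  rw [splitSum, Finset.mul_sum]
  refine Finset.sum_congr rfl fun p hp => ?_
  have h := mem_splits.mp hp
  have hN : ((r + k : ℕ) : ℤ) < ((r + 1 + k : ℕ) : ℤ) := by omega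
  rw [oddBlockSum, blockSum_snoc_left _ _ (by omega) (fun j => (h.v_le j).trans_lt hN),
    blockSum_snoc_left _ _ (by omega) (fun j => (h.v_le j).trans_lt hN)]
  have h2 : ∑ j : Fin k, (r + b + (j : ℕ)) % 2 = (k + (r + b) % 2) / 2 := by
    rw [← sum_mod_two]
    exact Finset.sum_congr rfl fun j _ => by rw [add_comm]
  rw [h2, ← oddBlockSum]
  simp only [Finset.sum_const, Finset.card_univ, Fintype.card_fin, smul_eq_mul, mul_one, pow_add]
  ring

/-- The terms correspond, in order, to `N` at the end of `v`, `-N` at the start of `v`, and `N` at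
the end of `u`. -/
theorem splitSum_succ_succ (r k b : ℕ) :
    splitSum x (r + 1) (k + 1) b = splitSum x (r + 1) k b +
      (-1) ^ k * x ^ (2 * ((r + 1 + b % 2) / 2) + (k + 1) / 2) * splitSum x (r + 1) k (b + 1) +
      (-1) ^ (k + 1) * x ^ ((k + 1 + (r + b) % 2) / 2) * splitSum x r (k + 1) b := by
  rw [splitSum, sum_splits_succ_succ, splitSum_snoc_left, splitSum_snoc_right,
    splitSum_cons_right]
  ring

theorem splitSum_zero_succ (k b : ℕ) :
    splitSum x 0 (k + 1) b = splitSum x 0 k b +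
      (-1) ^ k * x ^ ((k + 1) / 2) * splitSum x 0 k (b + 1) := by
  rw [splitSum, sum_splits_zero_succ, splitSum_snoc_right, splitSum_cons_right]
  have : (0 + b % 2) / 2 = 0 := by omega
  rw [this, mul_zero, zero_add]

end Weight

/-! ### Closed forms for all parities of the block lengths. -/

section ClosedForm

variable {F : Type*} [Field F] (x : F)

/-- The product `∏_{i=1}^n (1 - x^{2i})`. -/
def evenProd (n : ℕ) : F := ∏ i ∈ Finset.range n, (1 - x ^ (2 * (i + 1)))

lemma evenProd_succ (n : ℕ) : evenProd x (n + 1) = evenProd x n * (1 - x ^ (2 * (n + 1))) :=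
  Finset.prod_range_succ _ _

/-- The common factor of the closed forms. -/
def coreFactor (A K : ℕ) : F := evenProd x (A + K) ^ 2 / (evenProd x A ^ 2 * evenProd x K)

variable {x}

lemma evenProd_ne_zero (hx' : ∀ n : ℕ, 1 - x ^ (n + 1) ≠ 0) (n : ℕ) : evenProd x n ≠ 0 :=
  Finset.prod_ne_zero_iff.mpr fun i _ => hx' (2 * i + 1)

lemma coreFactor_zero (hx' : ∀ n : ℕ, 1 - x ^ (n + 1) ≠ 0) (A : ℕ) : coreFactor x A 0 = 1 := by
  have := evenProd_ne_zero hx' A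
  rw [coreFactor, add_zero, show evenProd x 0 = 1 from Finset.prod_range_zero _, mul_one]
  exact div_self (pow_ne_zero 2 this)

lemma coreFactor_eq_right (hx' : ∀ n : ℕ, 1 - x ^ (n + 1) ≠ 0) (A K : ℕ) :
    coreFactor x A K =
      coreFactor x A (K + 1) * (1 - x ^ (2 * (K + 1))) / (1 - x ^ (2 * (A + K + 1))) ^ 2 := by
  have h1 := evenProd_ne_zero hx' A
  have h2 := evenProd_ne_zero hx' K
  have h3 : 1 - x ^ (2 * (K + 1)) ≠ 0 := hx' (2 * K + 1)
  have h4 : 1 - x ^ (2 * (A + K + 1)) ≠ 0 := hx' (2 * (A + K) + 1)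
  rw [coreFactor, coreFactor, ← add_assoc, evenProd_succ, evenProd_succ]
  field_simp

lemma coreFactor_eq_left (hx' : ∀ n : ℕ, 1 - x ^ (n + 1) ≠ 0) (A K : ℕ) :
    coreFactor x A K =
      coreFactor x (A + 1) K * (1 - x ^ (2 * (A + 1))) ^ 2 / (1 - x ^ (2 * (A + K + 1))) ^ 2 := by
  have h1 := evenProd_ne_zero hx' A
  have h2 := evenProd_ne_zero hx' K
  have h3 : 1 - x ^ (2 * (A + 1)) ≠ 0 := hx' (2 * A + 1)
  have h4 : 1 - x ^ (2 * (A + K + 1)) ≠ 0 := hx' (2 * (A + K) + 1)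
  rw [coreFactor, coreFactor, add_right_comm, evenProd_succ, evenProd_succ]
  field_simp

/-- The closed form of `splitSum` for blocks of lengths `2A` and `2K`. -/
def EvenEven (x : F) (A K : ℕ) : Prop :=
  splitSum x (2 * A) (2 * K) 0 = coreFactor x A K *
      (1 + x ^ (2 * A) + 2 * x ^ (A + K)) / (1 + x ^ (A + K)) ^ 2 ∧
    splitSum x (2 * A) (2 * K) 1 = coreFactor x A K *
      (x ^ K * (1 + x ^ (2 * A)) + 2 * x ^ A) / (1 + x ^ (A + K)) ^ 2

/-- The closed form of `splitSum` for blocks of lengths `2A` and `2K + 1`. -/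
def EvenOdd (x : F) (A K : ℕ) : Prop :=
  splitSum x (2 * A) (2 * K + 1) 0 = coreFactor x A K * (1 + x ^ (2 * A)) ∧
    splitSum x (2 * A) (2 * K + 1) 1 = coreFactor x A K * (2 * x ^ A)

/-- The closed form of `splitSum` for blocks of lengths `2A + 1` and `2K`. -/
def OddEven (x : F) (A K : ℕ) : Prop :=
  splitSum x (2 * A + 1) (2 * K) 0 = coreFactor x A K * x ^ K ∧
    splitSum x (2 * A + 1) (2 * K) 1 = coreFactor x A K

/-- The closed form of `splitSum` for blocks of lengths `2A + 1` and `2K + 1`. -/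
def OddOdd (x : F) (A K : ℕ) : Prop :=
  splitSum x (2 * A + 1) (2 * K + 1) 0 = 0 ∧
    splitSum x (2 * A + 1) (2 * K + 1) 1 = coreFactor x A K * (1 - x ^ (A + K + 1)) ^ 2

lemma one_sub_pow_two_mul (n : ℕ) : 1 - x ^ (2 * n) = (1 - x ^ n) * (1 + x ^ n) := by
  rw [pow_mul']; ring

/-- For an empty `v` the sum is `1`, and the closed form collapses since `1 + x^{2A} + 2x^A = (1 +
x^A)^2`. For `A = 0` this divides by `2 ^ 2`, which `hx 0` permits. -/
lemma evenEven_zero_right (hx : ∀ n : ℕ, 1 + x ^ n ≠ 0) (hx' : ∀ n : ℕ, 1 - x ^ (n + 1) ≠ 0)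
    (A : ℕ) : EvenEven x A 0 := by
  have h := hx A
  constructor <;> rw [mul_zero, splitSum_zero, coreFactor_zero hx', add_zero] <;> field_simp <;>
    ring

lemma evenEven_zero_left (hx : ∀ n : ℕ, 1 + x ^ n ≠ 0) (hx' : ∀ n : ℕ, 1 - x ^ (n + 1) ≠ 0)
    {K : ℕ} (h : EvenOdd x 0 K) : EvenEven x 0 (K + 1) := by
  obtain ⟨h0, h1⟩ := h
  rw [mul_zero] at h0 h1
  have e1 : (2 * K + 1 + 1) / 2 = K + 1 := by omega
  have hs : (-1 : F) ^ (2 * K + 1) = -1 := Odd.neg_one_pow ⟨K, rfl⟩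
  have n1 := hx (K + 1)
  have n2 := hx' K
  constructor
  · rw [mul_zero, mul_add_one, splitSum_zero_succ, h0, zero_add, h1, e1, hs,
      coreFactor_eq_right hx', one_sub_pow_two_mul, one_sub_pow_two_mul]
    simp only [zero_add]
    field_simp
    ring
  -- At `b = 1` the recursion asks for `b = 2`, which `splitSum_add_two` folds back to `0`.
  · rw [mul_zero, mul_add_one, splitSum_zero_succ, h1, splitSum_add_two x _ _ 0, h0, e1, hs,
      coreFactor_eq_right hx', one_sub_pow_two_mul, one_sub_pow_two_mul]
    simp only [zero_add]
    field_simp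
    ring

lemma evenEven_succ (hx : ∀ n : ℕ, 1 + x ^ n ≠ 0) (hx' : ∀ n : ℕ, 1 - x ^ (n + 1) ≠ 0)
    {A K : ℕ} (h : EvenOdd x (A + 1) K) (h' : OddEven x A (K + 1)) :
    EvenEven x (A + 1) (K + 1) := by
  obtain ⟨h0, h1⟩ := h
  obtain ⟨h0', h1'⟩ := h'
  have hs : (-1 : F) ^ (2 * K + 1) = -1 := Odd.neg_one_pow ⟨K, rfl⟩
  have hs' : (-1 : F) ^ (2 * K + 1 + 1) = 1 := Even.neg_one_pow ⟨K + 1, by ring⟩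
  have n1 := hx (A + K + 2)
  have n2 := hx' (A + K + 1)
  have r : coreFactor x (A + 1) K = coreFactor x (A + 1) (K + 1) * (1 - x ^ (2 * (K + 1))) /
      ((1 - x ^ (A + K + 2)) * (1 + x ^ (A + K + 2))) ^ 2 := by
    rw [coreFactor_eq_right hx', one_sub_pow_two_mul (A + 1 + K + 1),
      show A + 1 + K + 1 = A + K + 2 by ring]
  have r' : coreFactor x A (K + 1) = coreFactor x (A + 1) (K + 1) * (1 - x ^ (2 * (A + 1))) ^ 2 /
      ((1 - x ^ (A + K + 2)) * (1 + x ^ (A + K + 2))) ^ 2 := by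
    rw [coreFactor_eq_left hx', one_sub_pow_two_mul (A + (K + 1) + 1),
      show A + (K + 1) + 1 = A + K + 2 by ring]
  rw [mul_add_one 2 A, mul_add_one 2 K] at *
  constructor
  · rw [mul_add_one 2 A, mul_add_one 2 K, splitSum_succ_succ, h0, zero_add, h1, h0', hs, hs', r, r',
      show 2 * ((2 * A + 1 + 1 + 0 % 2) / 2) + (2 * K + 1 + 1) / 2 = 2 * A + K + 3 by omega,
      show (2 * K + 1 + 1 + (2 * A + 1 + 0) % 2) / 2 = K + 1 by omega,
      show A + 1 + (K + 1) = A + K + 2 by ring]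
    field_simp
    ring
  · rw [mul_add_one 2 A, mul_add_one 2 K, splitSum_succ_succ, h1, splitSum_add_two x _ _ 0, h0, h1', hs, hs', r, r',
      show 2 * ((2 * A + 1 + 1 + 1 % 2) / 2) + (2 * K + 1 + 1) / 2 = 2 * A + K + 3 by omega,
      show (2 * K + 1 + 1 + (2 * A + 1 + 1) % 2) / 2 = K + 1 by omega,
      show A + 1 + (K + 1) = A + K + 2 by ring]
    field_simp
    ring

lemma evenOdd_zero_left (hx : ∀ n : ℕ, 1 + x ^ n ≠ 0) {K : ℕ} (h : EvenEven x 0 K) :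
    EvenOdd x 0 K := by
  obtain ⟨h0, h1⟩ := h
  rw [mul_zero] at h0 h1
  have e1 : (2 * K + 1) / 2 = K := by omega
  have hs : (-1 : F) ^ (2 * K) = 1 := Even.neg_one_pow ⟨K, by ring⟩
  have n1 := hx K
  constructor
  · rw [mul_zero, splitSum_zero_succ, h0, zero_add, h1, e1, hs]
    simp only [zero_add]
    field_simp
    ring
  · rw [mul_zero, splitSum_zero_succ, h1, splitSum_add_two x _ _ 0, h0, e1, hs]
    simp only [zero_add]
    field_simp
    ring

lemma evenOdd_succ (hx : ∀ n : ℕ, 1 + x ^ n ≠ 0) (hx' : ∀ n : ℕ, 1 - x ^ (n + 1) ≠ 0)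
    {A K : ℕ} (h : EvenEven x (A + 1) K) (h' : OddOdd x A K) : EvenOdd x (A + 1) K := by
  obtain ⟨h0, h1⟩ := h
  obtain ⟨h0', h1'⟩ := h'
  have hs : (-1 : F) ^ (2 * K) = 1 := Even.neg_one_pow ⟨K, by ring⟩
  have hs' : (-1 : F) ^ (2 * K + 1) = -1 := Odd.neg_one_pow ⟨K, rfl⟩
  have n1 := hx (A + K + 1)
  have n2 := hx' (A + K)
  have r : coreFactor x A K = coreFactor x (A + 1) K * (1 - x ^ (2 * (A + 1))) ^ 2 /
      ((1 - x ^ (A + K + 1)) * (1 + x ^ (A + K + 1))) ^ 2 := by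
    rw [coreFactor_eq_left hx', one_sub_pow_two_mul (A + K + 1)]
  rw [show A + 1 + K = A + K + 1 by ring] at h0 h1
  rw [mul_add_one 2 A] at *
  rw [r] at h1'
  constructor
  · rw [mul_add_one 2 A, splitSum_succ_succ, h0, zero_add, h1, h0', hs, hs',
      show 2 * ((2 * A + 1 + 1 + 0 % 2) / 2) + (2 * K + 1) / 2 = 2 * A + K + 2 by omega]
    field_simp
    ring
  · rw [mul_add_one 2 A, splitSum_succ_succ, h1, splitSum_add_two x _ _ 0, h0, h1', hs, hs',
      show 2 * ((2 * A + 1 + 1 + 1 % 2) / 2) + (2 * K + 1) / 2 = 2 * A + K + 2 by omega,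
      show (2 * K + 1 + (2 * A + 1 + 1) % 2) / 2 = K by omega]
    field_simp
    ring

lemma oddEven_zero_right (hx' : ∀ n : ℕ, 1 - x ^ (n + 1) ≠ 0) (A : ℕ) : OddEven x A 0 := by
  constructor <;> rw [mul_zero, splitSum_zero, coreFactor_zero hx']
  simp

lemma oddEven_succ (hx : ∀ n : ℕ, 1 + x ^ n ≠ 0) (hx' : ∀ n : ℕ, 1 - x ^ (n + 1) ≠ 0)
    {A K : ℕ} (h : OddOdd x A K) (h' : EvenEven x A (K + 1)) : OddEven x A (K + 1) := by
  obtain ⟨h0, h1⟩ := h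
  obtain ⟨h0', h1'⟩ := h'
  have hs : (-1 : F) ^ (2 * K + 1) = -1 := Odd.neg_one_pow ⟨K, rfl⟩
  have hs' : (-1 : F) ^ (2 * K + 1 + 1) = 1 := Even.neg_one_pow ⟨K + 1, by ring⟩
  have n1 := hx (A + K + 1)
  have n2 := hx' (A + K)
  have r : coreFactor x A K = coreFactor x A (K + 1) * (1 - x ^ (2 * (K + 1))) /
      ((1 - x ^ (A + K + 1)) * (1 + x ^ (A + K + 1))) ^ 2 := by
    rw [coreFactor_eq_right hx', one_sub_pow_two_mul (A + K + 1)]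
  rw [← add_assoc] at h0' h1'
  rw [mul_add_one 2 K] at *
  rw [r] at h1
  constructor
  · rw [mul_add_one 2 K, splitSum_succ_succ, h0, zero_add, h1, h0', hs, hs',
      show 2 * ((2 * A + 1 + 0 % 2) / 2) + (2 * K + 1 + 1) / 2 = 2 * A + K + 1 by omega,
      show (2 * K + 1 + 1 + (2 * A + 0) % 2) / 2 = K + 1 by omega]
    field_simp
    ring
  · rw [mul_add_one 2 K, splitSum_succ_succ, h1, splitSum_add_two x _ _ 0, h0, h1', hs, hs',
      show (2 * K + 1 + 1 + (2 * A + 1) % 2) / 2 = K + 1 by omega]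
    field_simp
    ring

/-- All terms share the same `coreFactor`. At `b = 0` they cancel as `x^K + x^{2A+K} - x^K (1 +
x^{2A})`; at `b = 1` they form the square `1 - 2x^{A+K+1} + x^{2(A+K+1)}`. -/
lemma oddOdd_of {A K : ℕ} (h : OddEven x A K) (h' : EvenOdd x A K) : OddOdd x A K := by
  obtain ⟨h0, h1⟩ := h
  obtain ⟨h0', h1'⟩ := h'
  have hs : (-1 : F) ^ (2 * K) = 1 := Even.neg_one_pow ⟨K, by ring⟩
  have hs' : (-1 : F) ^ (2 * K + 1) = -1 := Odd.neg_one_pow ⟨K, rfl⟩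
  constructor
  · rw [splitSum_succ_succ, h0, zero_add, h1, h0', hs, hs',
      show 2 * ((2 * A + 1 + 0 % 2) / 2) + (2 * K + 1) / 2 = 2 * A + K by omega,
      show (2 * K + 1 + (2 * A + 0) % 2) / 2 = K by omega]
    ring
  · rw [splitSum_succ_succ, h1, splitSum_add_two x _ _ 0, h0, h1', hs, hs',
      show 2 * ((2 * A + 1 + 1 % 2) / 2) + (2 * K + 1) / 2 = 2 * A + K + 2 by omega,
      show (2 * K + 1 + (2 * A + 1) % 2) / 2 = K + 1 by omega]
    ring

/-- The outer induction is on `K` and the inner one on `A`. `OddEven` need not be carried, since it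
follows from `OddOdd` at the previous `K` and `EvenEven` at the same indices. -/
theorem evenEven (hx : ∀ n : ℕ, 1 + x ^ n ≠ 0) (hx' : ∀ n : ℕ, 1 - x ^ (n + 1) ≠ 0)
    (A K : ℕ) : EvenEven x A K := by
  suffices h : EvenEven x A K ∧ EvenOdd x A K ∧ OddOdd x A K from h.1
  induction K generalizing A with
  | zero =>
    induction A with
    | zero =>
      have h := evenEven_zero_right hx hx' 0
      have h' := evenOdd_zero_left hx h
      exact ⟨h, h', oddOdd_of (oddEven_zero_right hx' 0) h'⟩
    | succ A ih =>
      have h := evenEven_zero_right hx hx' (A + 1)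
      have h' := evenOdd_succ hx hx' h ih.2.2
      exact ⟨h, h', oddOdd_of (oddEven_zero_right hx' _) h'⟩
  | succ K ihK =>
    induction A with
    | zero =>
      have h := evenEven_zero_left hx hx' (ihK 0).2.1
      have h' := evenOdd_zero_left hx h
      exact ⟨h, h', oddOdd_of (oddEven_succ hx hx' (ihK 0).2.2 h) h'⟩
    | succ A ih =>
      have h := evenEven_succ hx hx' (ihK (A + 1)).2.1
        (oddEven_succ hx hx' (ihK A).2.2 ih.1)
      have h' := evenOdd_succ hx hx' h ih.2.2
      exact ⟨h, h', oddOdd_of (oddEven_succ hx hx' (ihK (A + 1)).2.2 h) h'⟩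

end ClosedForm

/-! ### The parabolic quotient as the set of block pairs. -/

lemma eq_posPoint_or_negPoint {n : ℕ} (x : SignedIndex n) :
    (∃ i, x = posPoint i) ∨ ∃ i, x = negPoint i := by
  obtain ⟨h0, h1⟩ := Finset.mem_erase.mp x.2
  rw [Finset.mem_Icc] at h1
  rcases lt_or_gt_of_ne h0 with h | h
  · obtain ⟨i, hi⟩ := exists_fin_of_pos (n := n) (k := -(x : ℤ)) (by omega) (by omega)
    exact .inr ⟨i, Subtype.ext (by simp only [negPoint, point]; omega)⟩
  · obtain ⟨i, hi⟩ := exists_fin_of_pos (n := n) (k := (x : ℤ)) (by omega) (by omega)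
    exact .inl ⟨i, Subtype.ext (by simp only [posPoint, point]; omega)⟩

lemma IsSigned.ext_window {n : ℕ} {σ τ : Equiv.Perm (SignedIndex n)} (hσ : IsSigned σ)
    (hτ : IsSigned τ) (h : window σ = window τ) : σ = τ := by
  refine Equiv.ext fun x => Subtype.ext ?_
  obtain ⟨i, rfl⟩ | ⟨i, rfl⟩ := eq_posPoint_or_negPoint x
  · exact congrFun h i
  · rw [hσ.apply_negPoint, hτ.apply_negPoint, h]

/-- Every sequence with distinct absolute values is the one-line notation of a signed
permutation. -/
lemma exists_window_eq {n : ℕ} (g : Fin n → ℤ) (h0 : ∀ i, g i ≠ 0) (hn : ∀ i, |g i| ≤ n)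
    (hinj : Function.Injective fun i => |g i|) :
    ∃ σ : Equiv.Perm (SignedIndex n), IsSigned σ ∧ window σ = g := by
  have hx (x : SignedIndex n) : (x : ℤ) ≠ 0 ∧ (x : ℤ).natAbs - 1 < n := by
    obtain ⟨h0, h1⟩ := Finset.mem_erase.mp x.2
    rw [Finset.mem_Icc] at h1
    exact ⟨h0, by omega⟩
  -- The odd extension of `g`; the entry at `±k` is read at the zero-based position `k - 1`.
  let G (x : SignedIndex n) : ℤ := (x : ℤ).sign * g ⟨(x : ℤ).natAbs - 1, (hx x).2⟩
  have hGabs (x : SignedIndex n) : |G x| = |g ⟨(x : ℤ).natAbs - 1, (hx x).2⟩| := by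
    simp only [G, abs_mul, Int.abs_sign_of_ne_zero (hx x).1, one_mul]
  have hG0 (x : SignedIndex n) : G x ≠ 0 :=
    mul_ne_zero (mt Int.sign_eq_zero_iff_zero.mp (hx x).1) (h0 _)
  let f (x : SignedIndex n) : SignedIndex n :=
    ⟨G x, Finset.mem_erase.mpr ⟨hG0 x, Finset.mem_Icc.mpr
      (abs_le.mp ((hGabs x).le.trans (hn _)))⟩⟩
  have hf : Function.Injective f := by
    intro x y hxy
    have h1 : G x = G y := congrArg Subtype.val hxy
    have h2 := hinj ((hGabs x).symm.trans ((congrArg abs h1).trans (hGabs y)))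
    have h3 : (x : ℤ).sign = (y : ℤ).sign := by
      have : G y = (y : ℤ).sign * g ⟨(x : ℤ).natAbs - 1, (hx x).2⟩ := by rw [h2]
      rw [this] at h1
      exact mul_right_cancel₀ (h0 _) h1
    rw [Fin.mk.injEq] at h2
    have h4 := (hx x).1
    have h5 := (hx y).1
    refine Subtype.ext ?_
    rw [← Int.sign_mul_natAbs (x : ℤ), ← Int.sign_mul_natAbs (y : ℤ), h3,
      show (x : ℤ).natAbs = (y : ℤ).natAbs by omega]
  refine ⟨Equiv.ofBijective f (Finite.injective_iff_bijective.mp hf), ?_, ?_⟩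
  · intro i j hij
    simp only [Equiv.ofBijective_apply, f, G, hij, Int.sign_neg, Int.natAbs_neg, neg_mul]
  · funext i
    have : ((i : ℤ) + 1).natAbs - 1 = i := by omega
    simp only [window, Equiv.ofBijective_apply, f, G, posPoint, point, this, Fin.eta]
    rw [Int.sign_eq_one_of_pos (by omega), one_mul]

/-- Flipping one sign changes the parity of the number of negative entries. This makes the sign of
the first entry both adjustable and determined. -/
lemma card_neg_eq {n : ℕ} {g g' : Fin n → ℤ} {i₀ : Fin n} (h : ∀ i, i ≠ i₀ → g i = g' i)
    (h0 : g i₀ < 0) (h0' : ¬ g' i₀ < 0) :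
    (Finset.univ.filter fun i => g i < 0).card =
      (Finset.univ.filter fun i => g' i < 0).card + 1 := by
  rw [← Finset.card_erase_add_one (a := i₀) (by simpa using h0)]
  congr 2
  ext i
  by_cases hi : i = i₀
  · subst hi; simpa using h0'
  · simp [hi, h i hi]

lemma lt_of_lt_succ {n s t : ℕ} (f : Fin n → ℤ)
    (hf : ∀ k (hk : k + 1 < n), s ≤ k → k + 1 < t → f ⟨k, by omega⟩ < f ⟨k + 1, hk⟩)
    {i j : Fin n} (hs : s ≤ i) (hij : i < j) (ht : (j : ℕ) < t) : f i < f j := by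
  obtain ⟨i, hi⟩ := i
  obtain ⟨j, hj⟩ := j
  simp only [Fin.mk_lt_mk] at *
  induction j, hij using Nat.le_induction with
  | base => exact hf i hj hs ht
  | succ j hij' ih => exact (ih (by omega) (by omega)).trans (hf j hj (by omega) ht)

/-- The generator `s_{k+1}` compares the zero-based positions `k` and `k + 1`. The omitted `s_a` is
the comparison across the boundary between the blocks. -/
lemma mem_quotient_iff {a m : ℕ} (ha : 2 ≤ a) (hm : 0 < m)
    (w : Equiv.Perm (SignedIndex (a + m))) :
    w ∈ quotient (a + m) (Finset.Icc 0 (a - 1) ∪ Finset.Icc (a + 1) (a + m - 1)) ↔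
      IsSigned w ∧ Even (Finset.univ.filter fun i => window w i < 0).card ∧
      0 < window w ⟨0, by omega⟩ + window w ⟨1, by omega⟩ ∧
      (∀ i j : Fin a, i < j → window w (Fin.castAdd m i) < window w (Fin.castAdd m j)) ∧
      ∀ i j : Fin m, i < j → window w (Fin.natAdd a i) < window w (Fin.natAdd a j) := by
  simp only [quotient, evenHyperoctahedral, Finset.mem_filter, Finset.mem_univ, true_and,
    and_assoc]
  refine and_congr_right fun hw => and_congr (by simp only [window]; congr!) ?_
  constructor
  · intro h
    refine ⟨(len_lt_mul_zero hw (by omega)).mp (h 0 (by simp)), fun i j hij => ?_,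
      fun i j hij => ?_⟩
    · refine lt_of_lt_succ (s := 0) (t := a) _ (fun k hk _ hka => ?_) (by simp)
        (Fin.lt_def.mpr hij) (by simp)
      exact (len_lt_mul_succ hw hk).mp (h (k + 1) (by
        simp only [Finset.mem_union, Finset.mem_Icc]; omega))
    · refine lt_of_lt_succ (s := a) (t := a + m) _ (fun k hk hk' _ => ?_) (by simp)
        (Fin.lt_def.mpr (Nat.add_lt_add_left hij a)) (by simp)
      exact (len_lt_mul_succ hw hk).mp (h (k + 1) (by
        simp only [Finset.mem_union, Finset.mem_Icc]; omega))
  · rintro ⟨h0, h1, h2⟩ k hk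
    cases k with
    | zero => exact (len_lt_mul_zero hw (by omega)).mpr h0
    | succ k =>
      simp only [Finset.mem_union, Finset.mem_Icc] at hk
      rw [len_lt_mul_succ hw (by omega)]
      rcases hk with hk | hk
      · exact h1 ⟨k, by omega⟩ ⟨k + 1, by omega⟩ (by simp)
      · convert h2 ⟨k - a, by omega⟩ ⟨k + 1 - a, by omega⟩ (by simp only [Fin.mk_lt_mk]; omega)
          using 2 <;> simp only [Fin.ext_iff, Fin.val_natAdd] <;> omega

/-- The sequence of the absolute values of the first block of the one-line notation. -/
def leftBlock {a m : ℕ} (w : Equiv.Perm (SignedIndex (a + m))) (i : Fin a) : ℤ :=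
  |window w (Fin.castAdd m i)|

/-- The second block of the one-line notation. -/
def rightBlock {a m : ℕ} (w : Equiv.Perm (SignedIndex (a + m))) (j : Fin m) : ℤ :=
  window w (Fin.natAdd a j)

section Block

variable {a m : ℕ} {w : Equiv.Perm (SignedIndex (a + m))}

/-- From `w(1) < w(2)` and `w(1) + w(2) > 0` follows `|w(1)| < w(2)`, so every entry of the first
block after `w(1)` is positive. -/
lemma abs_lt_window (ha : 2 ≤ a)
    (h0 : 0 < window w ⟨0, by omega⟩ + window w ⟨1, by omega⟩)
    (h1 : ∀ i j : Fin a, i < j → window w (Fin.castAdd m i) < window w (Fin.castAdd m j))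
    {i j : Fin a} (hij : i < j) : |window w (Fin.castAdd m i)| < window w (Fin.castAdd m j) := by
  have h2 : window w ⟨0, by omega⟩ < window w ⟨1, by omega⟩ :=
    h1 ⟨0, by omega⟩ ⟨1, by omega⟩ (by simp)
  have h3 : ∀ j : Fin a, 0 < (j : ℕ) →
      window w ⟨1, by omega⟩ ≤ window w (Fin.castAdd m j) := by
    intro j hj
    rcases eq_or_ne (j : ℕ) 1 with h | h
    · exact le_of_eq (congrArg _ (Fin.ext h.symm))
    · exact (h1 ⟨1, by omega⟩ j (by rw [Fin.lt_def]; simp only; omega)).le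
  rw [Fin.lt_def] at hij
  rcases Nat.eq_zero_or_pos i with h | h
  · have h4 : Fin.castAdd m i = ⟨0, by omega⟩ := Fin.ext h
    have h5 := h3 j (by omega)
    rw [h4, abs_lt]; omega
  · have h4 := h3 i h
    rw [abs_of_pos (by omega)]
    exact h1 i j hij

lemma window_pos (ha : 2 ≤ a)
    (h0 : 0 < window w ⟨0, by omega⟩ + window w ⟨1, by omega⟩)
    (h1 : ∀ i j : Fin a, i < j → window w (Fin.castAdd m i) < window w (Fin.castAdd m j))
    {i : Fin a} (hi : 0 < (i : ℕ)) : 0 < window w (Fin.castAdd m i) :=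
  (abs_nonneg _).trans_lt (abs_lt_window ha h0 h1 (i := ⟨0, by omega⟩) (j := i) hi)

lemma isSplit_blocks (ha : 2 ≤ a) (hw : IsSigned w)
    (h0 : 0 < window w ⟨0, by omega⟩ + window w ⟨1, by omega⟩)
    (h1 : ∀ i j : Fin a, i < j → window w (Fin.castAdd m i) < window w (Fin.castAdd m j))
    (h2 : ∀ i j : Fin m, i < j → window w (Fin.natAdd a i) < window w (Fin.natAdd a j)) :
    IsSplit ((a + m : ℕ) : ℤ) (leftBlock w) (rightBlock w) where
  u_mono i j hij := (abs_lt_window ha h0 h1 hij).trans_le (le_abs_self _)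
  v_mono i j hij := h2 i j hij
  u_pos i := abs_pos.mpr (window_ne_zero _ _)
  u_le i := abs_window_le _ _
  v_ne j := window_ne_zero _ _
  v_le j := abs_window_le _ _
  v_inj j j' h := Fin.natAdd_injective _ _ (hw.abs_window_injective h)
  disj i j h := by
    have := hw.abs_window_injective h
    rw [Fin.ext_iff, Fin.val_castAdd, Fin.val_natAdd] at this
    omega

/-- Pairs inside the first block contribute nothing by `abs_lt_window`. In mixed pairs the
first-block entry is on the left, where its sign does not matter. -/
lemma sum_pairs_eq_blockSum (ha : 2 ≤ a)
    (h0 : 0 < window w ⟨0, by omega⟩ + window w ⟨1, by omega⟩)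
    (h1 : ∀ i j : Fin a, i < j → window w (Fin.castAdd m i) < window w (Fin.castAdd m j))
    (c : ℕ → ℕ → ℕ) :
    ∑ i : Fin (a + m), ∑ j : Fin (a + m),
      (if i < j then c i j * pairInv (window w i) (window w j) else 0) =
    blockSum (fun i j => c i (a + j)) (fun i j => c (a + i) (a + j)) (leftBlock w)
      (rightBlock w) := by
  have hl (i : Fin a) (y : ℤ) :
      pairInv |window w (Fin.castAdd m i)| y = pairInv (window w (Fin.castAdd m i)) y := by
    rcases abs_choice (window w (Fin.castAdd m i)) with h | h <;> rw [h]
    exact pairInv_neg_left _ _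
  have hz (i j : Fin a) : (if Fin.castAdd m i < Fin.castAdd m j then
      c i j * pairInv (window w (Fin.castAdd m i)) (window w (Fin.castAdd m j)) else 0) = 0 := by
    split_ifs with h
    · rw [pairInv_of_abs_lt (abs_lt_window ha h0 h1 (Fin.lt_def.mpr h)), mul_zero]
    · rfl
  have hlr (i : Fin a) (j : Fin m) : Fin.castAdd m i < Fin.natAdd a j := by
    rw [Fin.lt_def, Fin.val_castAdd, Fin.val_natAdd]; omega
  have hrr (i j : Fin m) : Fin.natAdd a i < Fin.natAdd a j ↔ i < j := by
    rw [Fin.lt_def, Fin.lt_def, Fin.val_natAdd, Fin.val_natAdd]; omega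
  simp only [Fin.sum_univ_add, blockSum, leftBlock, rightBlock, hl, hlr, (hlr _ _).not_gt, hrr,
    Fin.val_castAdd, Fin.val_natAdd, if_true, if_false, hz, Finset.sum_const_zero, zero_add]

lemma len_eq_blockSum (ha : 2 ≤ a) (hw : IsSigned w)
    (h0 : 0 < window w ⟨0, by omega⟩ + window w ⟨1, by omega⟩)
    (h1 : ∀ i j : Fin a, i < j → window w (Fin.castAdd m i) < window w (Fin.castAdd m j)) :
    len w = blockSum (fun _ _ => 1) (fun _ _ => 1) (leftBlock w) (rightBlock w) := by
  rw [len_eq hw, ← sum_pairs_eq_blockSum ha h0 h1 fun _ _ => 1]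
  simp only [one_mul]

/-- Evenness of `a` puts the start of the second block at an even zero-based position, hence `b =
0`. -/
lemma oddLen_eq_oddBlockSum (ha : 2 ≤ a) (ha' : Even a) (hw : IsSigned w)
    (h0 : 0 < window w ⟨0, by omega⟩ + window w ⟨1, by omega⟩)
    (h1 : ∀ i j : Fin a, i < j → window w (Fin.castAdd m i) < window w (Fin.castAdd m j)) :
    oddLen w = oddBlockSum 0 (leftBlock w) (rightBlock w) := by
  have h : oddBlockSum 0 (leftBlock w) (rightBlock w) =
      blockSum (fun i j => (i + (a + j)) % 2) (fun i j => (a + i + (a + j)) % 2) (leftBlock w)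
        (rightBlock w) := by
    obtain ⟨A, rfl⟩ := ha'
    rw [oddBlockSum]
    congr 1 <;> funext i j <;> omega
  rw [h, oddLen_eq hw, ← sum_pairs_eq_blockSum ha h0 h1 fun i j => (i + j) % 2]
  refine Finset.sum_congr rfl fun i _ => Finset.sum_congr rfl fun j _ => ?_
  rcases Nat.mod_two_eq_zero_or_one ((i : ℕ) + j) with h | h <;> simp [h]

lemma blocks_injOn {w w' : Equiv.Perm (SignedIndex (a + m))} (ha : 2 ≤ a) (hw : IsSigned w)
    (hw' : IsSigned w') (he : Even (Finset.univ.filter fun i => window w i < 0).card)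
    (he' : Even (Finset.univ.filter fun i => window w' i < 0).card)
    (hpos : ∀ i : Fin a, 0 < (i : ℕ) → 0 < window w (Fin.castAdd m i))
    (hpos' : ∀ i : Fin a, 0 < (i : ℕ) → 0 < window w' (Fin.castAdd m i))
    (hl : leftBlock w = leftBlock w') (hr : rightBlock w = rightBlock w') : w = w' := by
  have hne : ∀ i, i ≠ (⟨0, by omega⟩ : Fin (a + m)) → window w i = window w' i := by
    intro i
    refine Fin.addCases (fun i hi => ?_) (fun j _ => congrFun hr j) i
    have hi' : 0 < (i : ℕ) := by
      rw [ne_eq, Fin.ext_iff, Fin.val_castAdd] at hi; simp only at hi; omega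
    have h := congrFun hl i
    rwa [leftBlock, leftBlock, abs_of_pos (hpos i hi'), abs_of_pos (hpos' i hi')] at h
  have h0 : window w ⟨0, by omega⟩ = window w' ⟨0, by omega⟩ := by
    have h : |window w ⟨0, by omega⟩| = |window w' ⟨0, by omega⟩| :=
      congrFun hl ⟨0, by omega⟩
    by_cases h1 : window w ⟨0, by omega⟩ < 0 <;> by_cases h2 : window w' ⟨0, by omega⟩ < 0
    · rw [abs_of_neg h1, abs_of_neg h2] at h; omega
    · rw [card_neg_eq hne h1 h2] at he
      exact absurd he' (Nat.even_add_one.mp he)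
    · rw [card_neg_eq (fun i hi => (hne i hi).symm) h2 h1] at he'
      exact absurd he (Nat.even_add_one.mp he')
    · rw [abs_of_nonneg (by omega), abs_of_nonneg (by omega)] at h; exact h
  refine hw.ext_window hw' (funext fun i => ?_)
  by_cases hi : i = ⟨0, by omega⟩
  · rw [hi, h0]
  · exact hne i hi

lemma exists_blocks_eq (ha : 2 ≤ a) (hm : 0 < m) {u : Fin a → ℤ} {v : Fin m → ℤ}
    (h : IsSplit ((a + m : ℕ) : ℤ) u v) :
    ∃ w ∈ quotient (a + m) (Finset.Icc 0 (a - 1) ∪ Finset.Icc (a + 1) (a + m - 1)),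
      leftBlock w = u ∧ rightBlock w = v := by
  let i₀ : Fin a := ⟨0, by omega⟩
  let g (ε : ℤ) : Fin (a + m) → ℤ := Fin.append (Function.update u i₀ (ε * u i₀)) v
  have hgl (ε : ℤ) (i : Fin a) (hi : i ≠ i₀) : g ε (Fin.castAdd m i) = u i := by
    simp [g, hi]
  have hg0 (ε : ℤ) : g ε (Fin.castAdd m i₀) = ε * u i₀ := by simp [g]
  have hgr (ε : ℤ) (j : Fin m) : g ε (Fin.natAdd a j) = v j := by simp [g]
  have habs (ε : ℤ) (hε : |ε| = 1) (i : Fin a) : |g ε (Fin.castAdd m i)| = u i := by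
    by_cases hi : i = i₀
    · rw [hi, hg0, abs_mul, hε, one_mul, abs_of_pos (h.u_pos _)]
    · rw [hgl _ _ hi, abs_of_pos (h.u_pos _)]
  -- The sign of the smallest entry of `u` is the one free choice; it is spent on the parity
  -- condition.
  obtain ⟨ε, hε, heven⟩ : ∃ ε : ℤ, |ε| = 1 ∧
      Even (Finset.univ.filter fun i => g ε i < 0).card := by
    by_cases he : Even (Finset.univ.filter fun i => g 1 i < 0).card
    · exact ⟨1, by simp, he⟩
    · refine ⟨-1, by simp, ?_⟩
      have hu := h.u_pos i₀
      rw [card_neg_eq (g := g (-1)) (g' := g 1) (i₀ := Fin.castAdd m i₀) ?_ (by rw [hg0]; omega)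
        (by rw [hg0]; omega)]
      · exact Nat.even_add_one.mpr he
      · intro i
        refine Fin.addCases (fun i hi => ?_) (fun j _ => by rw [hgr, hgr]) i
        have hi' : i ≠ i₀ := fun hc => hi (by rw [hc])
        rw [hgl _ _ hi', hgl _ _ hi']
  have hne : ∀ i, g ε i ≠ 0 := by
    refine Fin.addCases (fun i => ?_) (fun j => by rw [hgr]; exact h.v_ne j)
    have := h.u_pos i
    rw [← habs ε hε i] at this
    exact abs_pos.mp this
  have hle : ∀ i, |g ε i| ≤ ((a + m : ℕ) : ℤ) := by
    refine Fin.addCases (fun i => ?_) (fun j => by rw [hgr]; exact h.v_le j)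
    rw [habs ε hε]; exact h.u_le i
  have hinj : Function.Injective fun i => |g ε i| := by
    intro i j
    refine Fin.addCases (fun i => ?_) (fun i => ?_) i <;>
      refine Fin.addCases (fun j => ?_) (fun j => ?_) j <;> intro hij <;>
      simp only [habs ε hε, hgr] at hij
    · rw [h.u_mono.injective hij]
    · exact absurd hij (h.disj i j)
    · exact absurd hij.symm (h.disj j i)
    · rw [h.v_inj i j hij]
  obtain ⟨w, hw, hwg⟩ := exists_window_eq (g ε) hne hle hinj
  have hlow : ∀ i, g ε (Fin.castAdd m i) ≤ u i := fun i => (le_abs_self _).trans (habs ε hε i).le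
  refine ⟨w, (mem_quotient_iff ha hm w).mpr ⟨hw, ?_, ?_, ?_, ?_⟩, ?_, ?_⟩
  · rwa [hwg]
  · have h1 : g ε (Fin.castAdd m ⟨1, by omega⟩) = u ⟨1, by omega⟩ :=
      hgl _ _ (by simp [i₀])
    have h2 : u i₀ < u ⟨1, by omega⟩ := h.u_mono (by simp [i₀, Fin.lt_def])
    have h3 : -u i₀ ≤ g ε (Fin.castAdd m i₀) := by
      rw [← habs ε hε i₀]; exact neg_abs_le _
    rw [hwg]
    change 0 < g ε (Fin.castAdd m i₀) + g ε (Fin.castAdd m ⟨1, by omega⟩)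
    omega
  · intro i j hij
    rw [hwg, hgl ε j (by rintro rfl; simp [i₀, Fin.lt_def] at hij)]
    exact (hlow i).trans_lt (h.u_mono hij)
  · intro i j hij
    rw [hwg, hgr, hgr]
    exact h.v_mono hij
  · funext i
    rw [leftBlock, hwg, habs ε hε]
  · funext j
    rw [rightBlock, hwg, hgr]

end Block

theorem sum_quotient_eq_splitSum {R : Type*} [CommRing R] (x : R) {a m : ℕ} (ha : 2 ≤ a)
    (ha' : Even a) (hm : 0 < m) :
    ∑ w ∈ quotient (a + m) (Finset.Icc 0 (a - 1) ∪ Finset.Icc (a + 1) (a + m - 1)),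
      (-1) ^ len w * x ^ oddLen w = splitSum x a m 0 := by
  refine Finset.sum_bij (fun w _ => (leftBlock w, rightBlock w)) ?_ ?_ ?_ ?_
  · intro w hw
    obtain ⟨hs, -, h0, h1, h2⟩ := (mem_quotient_iff ha hm w).mp hw
    exact mem_splits.mpr (isSplit_blocks ha hs h0 h1 h2)
  · intro w hw w' hw' heq
    obtain ⟨hs, he, h0, h1, -⟩ := (mem_quotient_iff ha hm w).mp hw
    obtain ⟨hs', he', h0', h1', -⟩ := (mem_quotient_iff ha hm w').mp hw'
    rw [Prod.mk.injEq] at heq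
    exact blocks_injOn ha hs hs' he he' (fun i => window_pos ha h0 h1)
      (fun i => window_pos ha h0' h1') heq.1 heq.2
  · rintro ⟨u, v⟩ hp
    obtain ⟨w, hw, rfl, rfl⟩ := exists_blocks_eq ha hm (mem_splits.mp hp)
    exact ⟨w, hw, rfl⟩
  · intro w hw
    obtain ⟨hs, -, h0, h1, -⟩ := (mem_quotient_iff ha hm w).mp hw
    rw [len_eq_blockSum ha hs h0 h1, oddLen_eq_oddBlockSum ha ha' hs h0 h1]

/-! ### Evaluation of the constant and of the product in the rational function field. -/

lemma one_add_X_pow_ne_zero (n : ℕ) : (1 : RatFunc ℤ) + RatFunc.X ^ n ≠ 0 := by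
  have h : algebraMap ℤ[X] (RatFunc ℤ) (1 + X ^ n) ≠ 0 := by
    rw [ne_eq, FaithfulSMul.algebraMap_eq_zero_iff]
    intro h
    have := congrArg (Polynomial.eval 1) h
    simp at this
  simpa [RatFunc.algebraMap_X] using h

lemma one_sub_X_pow_ne_zero (n : ℕ) : (1 : RatFunc ℤ) - RatFunc.X ^ (n + 1) ≠ 0 := by
  have h : algebraMap ℤ[X] (RatFunc ℤ) (1 - X ^ (n + 1)) ≠ 0 := by
    rw [ne_eq, FaithfulSMul.algebraMap_eq_zero_iff]
    intro h
    have := congrArg (Polynomial.eval 0) h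
    simp at this
  simpa [RatFunc.algebraMap_X] using h

lemma components_eq {a n : ℕ} (ha : 2 ≤ a) (hn : a + 2 ≤ n) :
    components (Finset.Icc 0 (a - 1) ∪ Finset.Icc (a + 1) (n - 1)) =
      {Finset.Icc 0 (a - 1), Finset.Icc (a + 1) (n - 1)} := by
  ext J
  simp only [components, Finset.mem_filter, Finset.mem_powerset, Finset.mem_insert,
    Finset.mem_singleton]
  constructor
  · rintro ⟨hJ, c, d, hcd, rfl, hc, hd⟩
    have h1 := hJ (Finset.mem_Icc.mpr ⟨le_rfl, hcd⟩)
    have h2 := hJ (Finset.mem_Icc.mpr ⟨hcd, le_rfl⟩)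
    -- For `c > 0` this says that `c` has no left neighbour in the set; for `c = 0` it is harmless.
    have h3 := hc (c - 1)
    have h4 : a ∉ Finset.Icc c d := fun h => by
      have := hJ h
      simp only [Finset.mem_union, Finset.mem_Icc] at this
      omega
    simp only [Finset.mem_union, Finset.mem_Icc] at h1 h2 h3 h4 hd
    rcases lt_or_ge c a with h | h
    · left
      rw [show c = 0 by omega, show d = a - 1 by omega]
    · right
      rw [show c = a + 1 by omega, show d = n - 1 by omega]
  · rintro (rfl | rfl)
    · refine ⟨Finset.subset_union_left, 0, a - 1, by omega, rfl, fun c _ => by omega, ?_⟩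
      simp only [Finset.mem_union, Finset.mem_Icc]; omega
    · refine ⟨Finset.subset_union_right, a + 1, n - 1, by omega, rfl, fun c hc => ?_, ?_⟩ <;>
        simp only [Finset.mem_union, Finset.mem_Icc] at * <;> omega

/-- The powers of `1 - x ^ 2` cancel in the multinomial, leaving only `evenProd`. -/
lemma qFactorial_sq (x : RatFunc ℤ) (m : ℕ) :
    qFactorial (x ^ 2) m = evenProd x m / (1 - x ^ 2) ^ m := by
  induction m with
  | zero => simp [qFactorial, evenProd]
  | succ m ih =>
    rw [qFactorial, Finset.prod_Icc_succ_top (by omega), ← qFactorial, ih, evenProd_succ, qNumber,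
      ← pow_mul, div_mul_div_comm, ← pow_succ]

lemma constC_eq {A K : ℕ} (hA : 1 ≤ A) (hK : 1 ≤ K) :
    constC (Finset.Icc 0 (2 * A - 1) ∪ Finset.Icc (2 * A + 1) (2 * A + 2 * K - 1)) =
      evenProd RatFunc.X (A + K) / (evenProd RatFunc.X A * evenProd RatFunc.X K) := by
  have hne : Finset.Icc 0 (2 * A - 1) ≠ Finset.Icc (2 * A + 1) (2 * A + 2 * K - 1) := fun h => by
    have : 0 ∈ Finset.Icc (2 * A + 1) (2 * A + 2 * K - 1) := h ▸ by simp
    simp at this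
  rw [constC, components_eq (by omega) (by omega), qMultinomial, Finset.sum_pair hne,
    Finset.prod_pair hne, Nat.card_Icc, Nat.card_Icc,
    show (2 * A - 1 + 1 - 0 + 1) / 2 = A by omega,
    show (2 * A + 2 * K - 1 + 1 - (2 * A + 1) + 1) / 2 = K by omega,
    qFactorial_sq, qFactorial_sq, qFactorial_sq]
  have h1 : (1 : RatFunc ℤ) - RatFunc.X ^ 2 ≠ 0 := one_sub_X_pow_ne_zero 1
  have h2 := evenProd_ne_zero one_sub_X_pow_ne_zero A
  have h3 := evenProd_ne_zero one_sub_X_pow_ne_zero K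
  field_simp
  ring

/-- The factors for `i = 2j` and `i = 2j + 1` multiply to `(1 - x^j)(1 + x^j) = 1 - x^{2j}`. The
range goes one step beyond `n` to complete the last pair. -/
lemma prod_Icc_eq {F : Type*} [Field F] {x : F} (hx' : ∀ n : ℕ, 1 - x ^ (n + 1) ≠ 0) (A K : ℕ) :
    ∏ i ∈ Finset.Icc (2 * A + 2) (2 * A + 2 * K + 1), (1 + (-1) ^ (i - 1) * x ^ (i / 2)) =
      evenProd x (A + K) / evenProd x A := by
  have h := evenProd_ne_zero hx' A
  induction K with
  | zero => simp [div_self h]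
  | succ K ih =>
    rw [show 2 * A + 2 * (K + 1) + 1 = 2 * A + 2 * K + 1 + 1 + 1 by ring,
      Finset.prod_Icc_succ_top (by omega), Finset.prod_Icc_succ_top (by omega), ih, ← add_assoc,
      evenProd_succ, show (2 * A + 2 * K + 1 + 1) / 2 = A + K + 1 by omega,
      show (2 * A + 2 * K + 1 + 1 + 1) / 2 = A + K + 1 by omega, one_sub_pow_two_mul,
      Odd.neg_one_pow (n := 2 * A + 2 * K + 1 + 1 - 1) ⟨A + K, by omega⟩,
      Even.neg_one_pow (n := 2 * A + 2 * K + 1 + 1 + 1 - 1) ⟨A + K + 1, by omega⟩]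
    ring

end

end OddLengthD

theorem proposition5p7 (n a₀ : ℕ) (ha : a₀ ∈ Finset.Icc 2 (n - 2))
    (ha_even : Even a₀) (hn_even : Even n) (I : Finset ℕ)
    (hI : I = Finset.Icc 0 (a₀ - 1) ∪ Finset.Icc (a₀ + 1) (n - 1)) :
    algebraMap (Polynomial ℤ) (RatFunc ℤ) (OddLengthD.genFun n I) =
      OddLengthD.constC I *
        ((1 + RatFunc.X ^ a₀ + 2 * RatFunc.X ^ (n / 2)) / (1 + RatFunc.X ^ (n / 2))) *
        ∏ i ∈ Finset.Icc (a₀ + 2) n, (1 + (-1) ^ (i - 1) * RatFunc.X ^ (i / 2)) := by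
  subst hI
  rw [Finset.mem_Icc] at ha
  obtain ⟨A, rfl⟩ := ha_even.two_dvd
  obtain ⟨N, rfl⟩ := hn_even.two_dvd
  -- Since `a₀ ≤ n - 2`, the second block is nonempty; its length is `2 * (K + 1)`.
  obtain ⟨K, rfl⟩ : ∃ K, N = A + (K + 1) := ⟨N - A - 1, by omega⟩
  rw [mul_add 2 A (K + 1), show (2 * A + 2 * (K + 1)) / 2 = A + (K + 1) by omega,
    OddLengthD.constC_eq (by omega) (by omega), OddLengthD.genFun, map_sum]
  simp only [map_mul, map_pow, map_neg, map_one, RatFunc.algebraMap_X]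
  rw [OddLengthD.sum_quotient_eq_splitSum _ (by omega) (even_two_mul A) (by omega),
    (OddLengthD.evenEven OddLengthD.one_add_X_pow_ne_zero OddLengthD.one_sub_X_pow_ne_zero A
      (K + 1)).1, OddLengthD.coreFactor]
  -- Splitting off the surplus factor `1 + x^{n/2}` at `i = n + 1` accounts for the square in the
  -- denominator of `EvenEven`.
  have h := OddLengthD.prod_Icc_eq OddLengthD.one_sub_X_pow_ne_zero A (K + 1)
  rw [Finset.prod_Icc_succ_top (by omega),
    show (2 * A + 2 * (K + 1) + 1) / 2 = A + (K + 1) by omega,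
    Even.neg_one_pow (n := 2 * A + 2 * (K + 1) + 1 - 1) ⟨A + (K + 1), by omega⟩, one_mul] at h
  have h1 := OddLengthD.one_add_X_pow_ne_zero (A + (K + 1))
  have h2 := OddLengthD.evenProd_ne_zero OddLengthD.one_sub_X_pow_ne_zero A
  have h3 := OddLengthD.evenProd_ne_zero OddLengthD.one_sub_X_pow_ne_zero (K + 1)
  rw [eq_div_of_mul_eq h1 h]
  field_simp
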